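/- Let $V$ be a $2$-dimensional real inner product space and let $\mathcal{P}(V)$ be the set of all convex polytopes in $V$ (convex hulls of finite sets; points, segments and $\varnothing$ included). Let $K_{\mathcal P}(V)$ be the quotient of the free abelian group on $\mathcal{P}(V)$ by the relations $[\varnothing]=0$; $[C\cup C']+[C\cap C']=[C]+[C']$ for all $C,C'\in\mathcal{P}(V)$ with $C\cup C'\in\mathcal{P}(V)$; and $[g(C)]=[C]$ for all $C\in\mathcal{P}(V)$ and all affine isometries $g$ of $V$. Let $V_0,V_1,V_2$ be the intrinsic volumes, that is, for a compact convex set $C\subset V$ with parallel bodies $C+\rho B$ ($B$ the closed unit disc), the coefficients in the Steiner formula $$\operatorname{area}(C+\rho B)=V_2(C)+2\rho\,V_1(C)+\pi\rho^2\,V_0(C)\qquad(\rho\ge 0);$$ thus $V_0$ is the Euler characteristic, $V_2$ the area, and $V_1$ half the perimeter (for a segment, its length). Then there is an isomorphism of groups $K_{\mathcal P}(V)\cong\mathbb{Z}\times\mathbb{R}^2$ that sends $[C]$ to $(V_0(C),V_1(C),V_2(C))$ for every $C\in\mathcal{P}(V)$. Moreover, let $\mathcal{P}_{\mathrm{ext}}(V)$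 be the smallest collection of subsets of $V$ that contains $\mathcal{P}(V)$ and is closed under finite unions, finite intersections and set differences. The maps $C\mapsto[C]$ and $C\mapsto V_i(C)$ ($0\le i\le 2$) on $\mathcal{P}(V)$ extend uniquely to valuations on $\mathcal{P}_{\mathrm{ext}}(V)$, that is, to maps $\psi$ with $\psi(\varnothing)=0$ and $\psi(P\cup Q)+\psi(P\cap Q)=\psi(P)+\psi(Q)$ for all $P,Q\in\mathcal{P}_{\mathrm{ext}}(V)$; denote the extensions by $[\cdot]$ and $V_i$ again. For all $P,P'\in\mathcal{P}_{\mathrm{ext}}(V)$, we have $[P]=[P']$ in $K_{\mathcal P}(V)$ if and only if $V_i(P)=V_i(P')$ for all $0\le i\le 2$. -/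

import Mathlib

open MeasureTheory
open scoped Pointwise

section Defs

variable {V : Type*} [NormedAddCommGroup V] [InnerProductSpace ℝ V]

/-- A convex polytope: the convex hull of a finite set. Lower-dimensional polytopes and
the empty set are included. -/
def IsPolytope (C : Set V) : Prop :=
  ∃ s : Set V, s.Finite ∧ C = convexHull ℝ s

variable (V) in
/-- The family of all convex polytopes of `V`. -/
def Polytope : Type _ := {C : Set V // IsPolytope C}

/-- The defining relations of the abstract dissection group, as a set of elements of the
free abelian group on the convex polytopes. In `union`, the set `I` is automatically a polytope. -/
inductive DissectionRel : FreeAbelianGroup (Polytope V) → Prop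
  | empty (E : Polytope V) (hE : E.1 = ∅) : DissectionRel (FreeAbelianGroup.of E)
  | union (C D U I : Polytope V) (hU : U.1 = C.1 ∪ D.1) (hI : I.1 = C.1 ∩ D.1) :
      DissectionRel (FreeAbelianGroup.of U + FreeAbelianGroup.of I
        - (FreeAbelianGroup.of C + FreeAbelianGroup.of D))
  | isometry (C D : Polytope V) (g : V ≃ᵃⁱ[ℝ] V) (hD : D.1 = g '' C.1) :
      DissectionRel (FreeAbelianGroup.of D - FreeAbelianGroup.of C)

variable (V) in
/-- The abstract dissection group of the convex polytopes of `V`: the free abelian group on the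
polytopes modulo `[∅] = 0`, `[C ∪ D] + [C ∩ D] = [C] + [D]` whenever `C ∪ D` is a polytope, and
`[g C] = [C]` for all affine isometries `g` of `V`. -/
abbrev DissectionGroup : Type _ :=
  FreeAbelianGroup (Polytope V) ⧸ AddSubgroup.closure {x | DissectionRel (V := V) x}

/-- The class of a convex polytope in the dissection group. -/
def polytopeClass (C : Polytope V) : DissectionGroup V :=
  QuotientAddGroup.mk (FreeAbelianGroup.of C)

/-- The relative Boolean algebra generated by the convex polytopes: the smallest collection of
sets that contains them and is closed under finite unions, finite intersections and
set differences. -/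
inductive IsExtPolytope : Set V → Prop
  | polytope (C : Set V) (hC : IsPolytope C) : IsExtPolytope C
  | union (P Q : Set V) (hP : IsExtPolytope P) (hQ : IsExtPolytope Q) : IsExtPolytope (P ∪ Q)
  | inter (P Q : Set V) (hP : IsExtPolytope P) (hQ : IsExtPolytope Q) : IsExtPolytope (P ∩ Q)
  | diff (P Q : Set V) (hP : IsExtPolytope P) (hQ : IsExtPolytope Q) : IsExtPolytope (P \ Q)

variable (V) in
/-- The members of the relative Boolean algebra generated by the convex polytopes. -/
def ExtPolytope : Type _ := {P : Set V // IsExtPolytope P}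

/-- `ψ` is a valuation on the relative Boolean algebra generated by the convex polytopes,
and it extends the function `φ` on polytopes. -/
structure IsValuationExtension {A : Type*} [AddCommGroup A]
    (φ : Polytope V → A) (ψ : ExtPolytope V → A) : Prop where
  extends_polytope : ∀ C : Polytope V, ψ ⟨C.1, .polytope C.1 C.2⟩ = φ C
  empty : ∀ E : ExtPolytope V, E.1 = ∅ → ψ E = 0
  union_add_inter : ∀ P Q : ExtPolytope V,
    ψ ⟨P.1 ∪ Q.1, .union P.1 Q.1 P.2 Q.2⟩ + ψ ⟨P.1 ∩ Q.1, .inter P.1 Q.1 P.2 Q.2⟩ = ψ P + ψ Q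

open Classical in
/-- The extension of a function on polytopes to a valuation on the relative Boolean algebra
generated by the polytopes (and `0` if there is no extension). -/
noncomputable def valuationExtension {A : Type*} [AddCommGroup A]
    (φ : Polytope V → A) : ExtPolytope V → A :=
  if h : ∃ ψ : ExtPolytope V → A, IsValuationExtension φ ψ then h.choose else 0

/-- The volume `κ_k` of the `k`-dimensional Euclidean unit ball. -/
noncomputable def unitBallVolume (k : ℕ) : ℝ :=
  volume.real (Metric.closedBall (0 : EuclideanSpace ℝ (Fin k)) 1)

variable [FiniteDimensional ℝ V] [MeasurableSpace V] [BorelSpace V]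

/-- `p` is the Steiner polynomial of `K`: the `n`-dimensional volume of the parallel body
`K + ρB` is `p(ρ)` for all `ρ ≥ 0`. There is at most one such polynomial. -/
def IsSteinerPolynomial (K : Set V) (p : Polynomial ℝ) : Prop :=
  ∀ ρ : ℝ, 0 ≤ ρ → volume.real (K + Metric.closedBall (0 : V) ρ) = p.eval ρ

open Classical in
/-- The Steiner polynomial of `K`. It exists for every compact convex set `K`
(and is set to `0` where there is none). -/
noncomputable def steinerPolynomial (K : Set V) : Polynomial ℝ :=
  if h : ∃ p : Polynomial ℝ, IsSteinerPolynomial K p then h.choose else 0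

/-- The `j`-th intrinsic volume of a compact convex set `K` in a space of dimension `n`, defined by
the Steiner formula `vol_n (K + ρB) = ∑_{j=0}^n κ_{n-j} V_j(K) ρ^{n-j}` for `ρ ≥ 0`. -/
noncomputable def intrinsicVolume (j : ℕ) (K : Set V) : ℝ :=
  if j ≤ Module.finrank ℝ V then
    (steinerPolynomial K).coeff (Module.finrank ℝ V - j)
      / unitBallVolume (Module.finrank ℝ V - j)
  else 0

/-- The `j`-th intrinsic volume as a function on the convex polytopes. -/
noncomputable def polytopeVolume (j : ℕ) (C : Polytope V) : ℝ :=
  intrinsicVolume j C.1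

/-- The class in the dissection group of a member of the relative Boolean algebra generated
by the polytopes. -/
noncomputable def extClass (P : ExtPolytope V) : DissectionGroup V :=
  valuationExtension polytopeClass P

/-- The `j`-th intrinsic volume of a member of the relative Boolean algebra generated
by the polytopes. -/
noncomputable def extVolume (j : ℕ) (P : ExtPolytope V) : ℝ :=
  valuationExtension (polytopeVolume j) P

end Defs

/-! Generators and relations give a surjection `ℤ × ℝ × ℝ → DissectionGroup V`, and volumes of
parallel bodies show that it is injective.

Surjectivity. A polygon with at least four vertices is cut along a diagonal into polygons with fewer
vertices, so points, segments and triangles generate. The class of a segment depends only on its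
length and becomes additive in it after a point is subtracted; this gives `σ`. The half-open
parallelogram class is invariant under shears and isometries, hence depends only on the area, and is
additive in it; this gives `q`. A triangle is rearranged into a parallelogram up to segments. Hence
every class has the form `n • pointClass V + σ x + q y`.

Injectivity. The volume of `C + ρB` is the integral over `x` of the Euler characteristic of `C ∩
closedBall x ρ`. The Euler characteristic of compact convex sets respects every linear relation
between indicator functions (`sum_convexEuler_eq_zero`), so the parallel volume descends to the
dissection group. Composed with `σ` and `q` it is an additive function on `ℝ`, within sublinear
error of `2ρx` and of `y`, and therefore equal to them. Its value at `(n, x, y)` is thus `y + 2xρ +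
πnρ²`, which determines `n`, `x` and `y`. This proves the Steiner formula for polygons at the same
time and identifies the coordinates with the intrinsic volumes.

Extension. An indicator relation kills all parallel volumes, hence all coordinates, hence the class;
so `polytopeClass` extends to a valuation. The volumes extend as coordinates of that valuation, and
the final equivalence is the injectivity of the isomorphism. -/

/-! ### Polytopes are closed under half-space cuts and intersections. -/

section FiniteHull

variable {E F : Type*} [AddCommGroup E] [Module ℝ E] [AddCommGroup F] [Module ℝ F]

/-- A set is the convex hull of a finite set (in an arbitrary real vector space). -/
def IsFiniteHull (C : Set E) : Prop :=
  ∃ s : Set E, s.Finite ∧ C = convexHull ℝ s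

theorem IsFiniteHull.convex {C : Set E} (hC : IsFiniteHull C) : Convex ℝ C := by
  obtain ⟨s, -, rfl⟩ := hC
  exact convex_convexHull ℝ s

theorem IsFiniteHull.image {C : Set E} (hC : IsFiniteHull C) (f : E →ᵃ[ℝ] F) :
    IsFiniteHull (f '' C) := by
  obtain ⟨s, hs, rfl⟩ := hC
  exact ⟨f '' s, hs.image f, f.image_convexHull s⟩

theorem IsFiniteHull.prod {C : Set E} {D : Set F} (hC : IsFiniteHull C) (hD : IsFiniteHull D) :
    IsFiniteHull (C ×ˢ D) := by
  obtain ⟨s, hs, rfl⟩ := hC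
  obtain ⟨t, ht, rfl⟩ := hD
  exact ⟨s ×ˢ t, hs.prod ht, (convexHull_prod s t).symm⟩

theorem isFiniteHull_segment (x y : E) : IsFiniteHull (segment ℝ x y) :=
  ⟨{x, y}, by simp, (convexHull_pair x y).symm⟩

theorem isFiniteHull_singleton (x : E) : IsFiniteHull ({x} : Set E) :=
  ⟨{x}, by simp, (convexHull_singleton x).symm⟩

theorem isFiniteHull_empty : IsFiniteHull (∅ : Set E) :=
  ⟨∅, by simp, convexHull_empty.symm⟩

/-- For `f z < k ≤ f y`, the point of the segment from `y` to `z` at level `k` of `f`. -/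
noncomputable def crossPoint (f : E →ₗ[ℝ] ℝ) (k : ℝ) (y z : E) : E :=
  (f y - f z)⁻¹ • ((f y - k) • z + (k - f z) • y)

theorem crossPoint_mem_segment (f : E →ₗ[ℝ] ℝ) {k : ℝ} {y z : E} (hy : k ≤ f y) (hz : f z < k) :
    crossPoint f k y z ∈ segment ℝ y z := by
  have hD : 0 < f y - f z := by linarith
  refine ⟨(k - f z) / (f y - f z), (f y - k) / (f y - f z), by
    apply div_nonneg <;> linarith, by apply div_nonneg <;> linarith, by field_simp; ring, ?_⟩
  rw [crossPoint, smul_add, smul_smul, smul_smul, div_eq_inv_mul, div_eq_inv_mul, add_comm]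

theorem map_crossPoint (f : E →ₗ[ℝ] ℝ) {k : ℝ} {y z : E} (hy : k ≤ f y) (hz : f z < k) :
    f (crossPoint f k y z) = k := by
  have hD : f y - f z ≠ 0 := by linarith
  simp only [crossPoint, map_smul, map_add, smul_eq_mul]
  field_simp
  ring

theorem mem_segment_crossPoint (f : E →ₗ[ℝ] ℝ) {k : ℝ} {x y z : E} (hy : k ≤ f y) (hz : f z < k)
    (hx : k ≤ f x) (hxs : x ∈ segment ℝ y z) : x ∈ segment ℝ y (crossPoint f k y z) := by
  have hD : 0 < f y - f z := by linarith
  obtain ⟨a, b, ha, hb, hab, rfl⟩ := hxs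
  obtain rfl : a = 1 - b := by linarith
  simp only [map_add, map_smul, smul_eq_mul] at hx
  rcases hy.eq_or_lt with rfl | hy
  · have : b = 0 := by nlinarith
    subst this
    simpa using left_mem_segment ℝ y _
  have hyk : 0 < f y - k := by linarith
  have hle : b * (f y - f z) ≤ f y - k := by linarith
  refine ⟨1 - b * (f y - f z) / (f y - k), b * (f y - f z) / (f y - k), ?_, by positivity,
    by ring, ?_⟩
  · rw [sub_nonneg, div_le_one hyk]; exact hle
  · rw [crossPoint]
    have h1 : b * (f y - f z) / (f y - k) * (f y - f z)⁻¹ * (f y - k) = b := by field_simp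
    have h2 : b * (f y - f z) / (f y - k) * (f y - f z)⁻¹ * (k - f z)
        = b * (f y - f z) / (f y - k) - b := by field_simp; ring
    rw [smul_smul, smul_add, smul_smul, smul_smul, h1, h2]
    module

/-- For fixed `y`, `crossPoint f k y` is the central projection from `y` to the level `k`. It is a
projective map: it carries convex combinations to convex combinations once the weights are rescaled
by `f y - f z`. -/
theorem convex_crossPoint_right (f : E →ₗ[ℝ] ℝ) (k : ℝ) {Q : Set E} (hQ : Convex ℝ Q) {y : E}
    (hy : k ≤ f y) : Convex ℝ {z | f z < k ∧ crossPoint f k y z ∈ Q} := by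
  rintro z₁ ⟨h₁, hz₁⟩ z₂ ⟨h₂, hz₂⟩ a b ha hb hab
  obtain rfl : b = 1 - a := by linarith
  have hf : f (a • z₁ + (1 - a) • z₂) < k := by
    simp only [map_add, map_smul, smul_eq_mul]
    rcases ha.eq_or_lt with rfl | ha
    · linarith
    · nlinarith
  refine ⟨hf, ?_⟩
  have hD : 0 < f y - f (a • z₁ + (1 - a) • z₂) := by linarith
  have hD₁ : 0 < f y - f z₁ := by linarith
  have hD₂ : 0 < f y - f z₂ := by linarith
  have key := hQ hz₁ hz₂ (a := a * (f y - f z₁) / (f y - f (a • z₁ + (1 - a) • z₂)))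
    (b := (1 - a) * (f y - f z₂) / (f y - f (a • z₁ + (1 - a) • z₂)))
    (by positivity) (by positivity) (by
      field_simp
      simp only [map_add, map_smul, smul_eq_mul]
      ring)
  convert key using 1
  simp only [crossPoint, smul_smul]
  rw [show a * (f y - f z₁) / (f y - f (a • z₁ + (1 - a) • z₂)) * (f y - f z₁)⁻¹
      = (f y - f (a • z₁ + (1 - a) • z₂))⁻¹ * a by field_simp,
    show (1 - a) * (f y - f z₂) / (f y - f (a • z₁ + (1 - a) • z₂)) * (f y - f z₂)⁻¹
      = (f y - f (a • z₁ + (1 - a) • z₂))⁻¹ * (1 - a) by field_simp,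
    mul_smul, mul_smul, ← smul_add]
  congr 1
  simp only [map_add, map_smul, smul_eq_mul]
  module

theorem convex_crossPoint_left (f : E →ₗ[ℝ] ℝ) (k : ℝ) {Q : Set E} (hQ : Convex ℝ Q) {z : E}
    (hz : f z < k) : Convex ℝ {y | k ≤ f y ∧ crossPoint f k y z ∈ Q} := by
  rintro y₁ ⟨h₁, hy₁⟩ y₂ ⟨h₂, hy₂⟩ a b ha hb hab
  obtain rfl : b = 1 - a := by linarith
  have hf : k ≤ f (a • y₁ + (1 - a) • y₂) := by
    simp only [map_add, map_smul, smul_eq_mul]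
    nlinarith
  refine ⟨hf, ?_⟩
  have hD : 0 < f (a • y₁ + (1 - a) • y₂) - f z := by linarith
  have hD₁ : 0 < f y₁ - f z := by linarith
  have hD₂ : 0 < f y₂ - f z := by linarith
  have key := hQ hy₁ hy₂ (a := a * (f y₁ - f z) / (f (a • y₁ + (1 - a) • y₂) - f z))
    (b := (1 - a) * (f y₂ - f z) / (f (a • y₁ + (1 - a) • y₂) - f z))
    (by positivity) (by positivity) (by
      field_simp
      simp only [map_add, map_smul, smul_eq_mul]
      ring)
  convert key using 1
  simp only [crossPoint, smul_smul]
  rw [show a * (f y₁ - f z) / (f (a • y₁ + (1 - a) • y₂) - f z) * (f y₁ - f z)⁻¹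
      = (f (a • y₁ + (1 - a) • y₂) - f z)⁻¹ * a by field_simp,
    show (1 - a) * (f y₂ - f z) / (f (a • y₁ + (1 - a) • y₂) - f z) * (f y₂ - f z)⁻¹
      = (f (a • y₁ + (1 - a) • y₂) - f z)⁻¹ * (1 - a) by field_simp,
    mul_smul, mul_smul, ← smul_add]
  congr 1
  simp only [map_add, map_smul, smul_eq_mul]
  module

/-- The section is spanned by the generators in the half-space together with the crossing points of
pairs of generators on opposite sides. The convexity of the two preimages under `crossPoint` passes
from generators to arbitrary points of their hulls, one argument at a time. -/
theorem IsFiniteHull.inter_le {C : Set E} (hC : IsFiniteHull C) (f : E →ₗ[ℝ] ℝ) (k : ℝ) :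
    IsFiniteHull (C ∩ {x | k ≤ f x}) := by
  obtain ⟨s, hs, rfl⟩ := hC
  set p := {x ∈ s | k ≤ f x} with hp
  set m := {x ∈ s | f x < k} with hm
  set T := p ∪ Set.image2 (crossPoint f k) p m with hT
  have hpf : p.Finite := hs.subset (Set.sep_subset _ _)
  have hmf : m.Finite := hs.subset (Set.sep_subset _ _)
  have hpm : s = p ∪ m := by
    ext x; simp only [hp, hm, Set.mem_union, Set.mem_sep_iff]
    rcases le_or_gt k (f x) with h | h
    · simp [h]
    · simp [h]
  have hhalf : Convex ℝ {x | k ≤ f x} := convex_halfSpace_ge f.isLinear k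
  have hlow : Convex ℝ {x | f x < k} := convex_halfSpace_lt f.isLinear k
  refine ⟨T, hpf.union (hpf.image2 _ hmf), Set.Subset.antisymm ?_ ?_⟩
  · rintro x ⟨hx, hfx⟩
    rcases p.eq_empty_or_nonempty with hpe | hpne
    · have : convexHull ℝ s ⊆ {x | f x < k} :=
        convexHull_min (by rw [hpm, hpe]; rintro z (hz | hz); exacts [hz.elim, hz.2]) hlow
      exact absurd (show f x < k from this hx) (not_lt.2 hfx)
    rcases m.eq_empty_or_nonempty with hme | hmne
    · rw [hpm, hme, Set.union_empty] at hx
      exact convexHull_mono Set.subset_union_left hx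
    rw [hpm, convexHull_union hpne hmne, mem_convexJoin] at hx
    obtain ⟨y, hy, z, hz, hxyz⟩ := hx
    have hfy : k ≤ f y := convexHull_min (fun a ha => ha.2) hhalf hy
    have hfz : f z < k := convexHull_min (fun a ha => ha.2) hlow hz
    have hcross : crossPoint f k y z ∈ convexHull ℝ T := by
      have hQ := convex_convexHull ℝ T
      have h1 : ∀ z' ∈ m, crossPoint f k y z' ∈ convexHull ℝ T := fun z' hz' =>
        (convexHull_min (t := {y | k ≤ f y ∧ crossPoint f k y z' ∈ convexHull ℝ T})
          (fun y' hy' => ⟨hy'.2, subset_convexHull ℝ T (Or.inr ⟨y', hy', z', hz', rfl⟩)⟩)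
          (convex_crossPoint_left f k hQ hz'.2) hy).2
      exact (convexHull_min (t := {z | f z < k ∧ crossPoint f k y z ∈ convexHull ℝ T})
        (fun z' hz' => ⟨hz'.2, h1 z' hz'⟩) (convex_crossPoint_right f k hQ hfy) hz).2
    exact (convex_convexHull ℝ T).segment_subset
      (convexHull_mono Set.subset_union_left hy) hcross
      (mem_segment_crossPoint f hfy hfz hfx hxyz)
  · refine convexHull_min ?_ ((convex_convexHull ℝ s).inter hhalf)
    rintro x (hx | ⟨y, hy, z, hz, rfl⟩)
    · exact ⟨subset_convexHull ℝ s hx.1, hx.2⟩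
    · exact ⟨(convex_convexHull ℝ s).segment_subset (subset_convexHull ℝ s hy.1)
        (subset_convexHull ℝ s hz.1) (crossPoint_mem_segment f hy.2 hz.2),
        (map_crossPoint f hy.2 hz.2).ge⟩

theorem IsFiniteHull.inter_ge {C : Set E} (hC : IsFiniteHull C) (f : E →ₗ[ℝ] ℝ) (k : ℝ) :
    IsFiniteHull (C ∩ {x | f x ≤ k}) := by
  simpa using hC.inter_le (-f) (-k)

theorem IsFiniteHull.inter_eq {C : Set E} (hC : IsFiniteHull C) (f : E →ₗ[ℝ] ℝ) (k : ℝ) :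
    IsFiniteHull (C ∩ {x | f x = k}) := by
  convert (hC.inter_le f k).inter_ge f k using 1
  ext x
  simp only [Set.mem_inter_iff, Set.mem_ofPred_eq, and_assoc, le_antisymm_iff]
  tauto

/-- The intersection is the first projection of `C ×ˢ D` cut with the diagonal, and the diagonal is
an intersection of finitely many hyperplanes, one for each coordinate. -/
theorem IsFiniteHull.inter [FiniteDimensional ℝ E] {C D : Set E} (hC : IsFiniteHull C)
    (hD : IsFiniteHull D) : IsFiniteHull (C ∩ D) := by
  let b := Module.finBasis ℝ E
  have key : ∀ t : Finset (Fin (Module.finrank ℝ E)),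
      IsFiniteHull ((C ×ˢ D) ∩ {p : E × E | ∀ i ∈ t, b.coord i p.1 = b.coord i p.2}) := by
    intro t
    induction t using Finset.induction_on with
    | empty => simpa using hC.prod hD
    | insert i t _ ih =>
      convert ih.inter_eq ((b.coord i) ∘ₗ (LinearMap.fst ℝ E E - LinearMap.snd ℝ E E)) 0 using 1
      ext p
      simp [sub_eq_zero]
      tauto
  convert (key Finset.univ).image (LinearMap.fst ℝ E E).toAffineMap using 1
  ext x
  simp only [Set.mem_inter_iff, Set.mem_image, Set.mem_prod, Set.mem_ofPred_eq, Prod.exists]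
  constructor
  · rintro ⟨h1, h2⟩
    exact ⟨x, x, ⟨⟨h1, h2⟩, fun _ _ => rfl⟩, rfl⟩
  · rintro ⟨y, z, ⟨⟨h1, h2⟩, h⟩, rfl⟩
    obtain rfl : y = z := b.ext_elem fun i => h i (Finset.mem_univ i)
    exact ⟨h1, h2⟩

end FiniteHull

/-! ### Euler characteristic, indicator relations and the parallel volume. -/

section EulerCharacteristic

open Filter Topology

variable {ι α β : Type*}

open Classical in
/-- The Euler characteristic of a compact convex set: `1` if it is nonempty and `0` otherwise. -/
noncomputable def convexEuler (S : Set α) : ℤ :=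
  if S.Nonempty then 1 else 0

theorem convexEuler_image (f : α → β) (S : Set α) : convexEuler (f '' S) = convexEuler S := by
  by_cases h : S.Nonempty <;> simp [convexEuler, h]

theorem convexEuler_eq_indicator {S : Set α} {T : Set β} {x : β} (h : S.Nonempty ↔ x ∈ T) :
    convexEuler S = T.indicator (fun _ => (1 : ℤ)) x := by
  classical
  simp [convexEuler, Set.indicator_apply, h]

/-- The jump of the indicator of `K` just to the right of `b` detects whether `b` is the right
endpoint. This makes endpoint counting linear in indicators. -/
theorem eventually_indicator_sub {K : Set ℝ} (hc : Convex ℝ K) (hk : IsClosed K) (b : ℝ)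
    [Decidable (IsGreatest K b)] :
    ∀ᶠ y in 𝓝[>] b, (if IsGreatest K b then (1 : ℤ) else 0) =
      K.indicator (fun _ => (1 : ℤ)) b - K.indicator (fun _ => (1 : ℤ)) y := by
  classical
  by_cases hb : b ∈ K
  · by_cases hg : IsGreatest K b
    · filter_upwards [self_mem_nhdsWithin] with y hy
      have : y ∉ K := fun h => absurd (hg.2 h) (not_le.2 hy)
      simp [hg, hb, this]
    · obtain ⟨c, hcK, hbc⟩ : ∃ c ∈ K, b < c := by
        by_contra! h
        exact hg ⟨hb, fun c hc => h c hc⟩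
      filter_upwards [Ioo_mem_nhdsGT hbc] with y hy
      have : y ∈ K := hc.ordConnected.out hb hcK ⟨hy.1.le, hy.2.le⟩
      simp [hg, hb, this]
  · have hg : ¬ IsGreatest K b := fun h => hb h.1
    filter_upwards [mem_nhdsWithin_of_mem_nhds (hk.isOpen_compl.mem_nhds hb)] with y hy
    have : y ∉ K := hy
    simp [hg, hb, this]

/-- The Euler characteristic of a compact interval is the number of its right endpoints, a finite
sum of jumps of its indicator. -/
theorem sum_convexEuler_eq_zero_real (s : Finset ι) (n : ι → ℤ) (K : ι → Set ℝ)
    (hc : ∀ i ∈ s, Convex ℝ (K i)) (hk : ∀ i ∈ s, IsCompact (K i))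
    (h : ∀ x, ∑ i ∈ s, n i * (K i).indicator (fun _ => (1 : ℤ)) x = 0) :
    ∑ i ∈ s, n i * convexEuler (K i) = 0 := by
  classical
  have hpt : ∀ b, ∑ i ∈ s, n i * (if IsGreatest (K i) b then (1 : ℤ) else 0) = 0 := by
    intro b
    have hev : ∀ᶠ y in 𝓝[>] b, ∀ i ∈ s, (if IsGreatest (K i) b then (1 : ℤ) else 0) =
        (K i).indicator (fun _ => (1 : ℤ)) b - (K i).indicator (fun _ => (1 : ℤ)) y :=
      (Filter.eventually_all_finset s).2 fun i hi =>
        eventually_indicator_sub (hc i hi) (hk i hi).isClosed b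
    obtain ⟨y, hy⟩ := hev.exists
    rw [Finset.sum_congr rfl fun i hi => by rw [hy i hi, mul_sub], Finset.sum_sub_distrib, h, h,
      sub_zero]
  have hchi : ∀ i ∈ s, convexEuler (K i) =
      ∑ b ∈ s.image fun i => sSup (K i), if IsGreatest (K i) b then (1 : ℤ) else 0 := by
    intro i hi
    by_cases hne : (K i).Nonempty
    · have hg : IsGreatest (K i) (sSup (K i)) := (hk i hi).isGreatest_sSup hne
      rw [Finset.sum_eq_single (sSup (K i))]
      · simp [convexEuler, hne, hg]
      · intro b _ hb
        rw [if_neg fun h' => hb (h'.unique hg)]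
      · intro h'
        exact absurd (Finset.mem_image_of_mem _ hi) h'
    · rw [Finset.sum_eq_zero]
      · simp [convexEuler, hne]
      · intro b _
        rw [if_neg fun h' => hne h'.nonempty]
  rw [Finset.sum_congr rfl fun i hi => by rw [hchi i hi, Finset.mul_sum], Finset.sum_comm]
  exact Finset.sum_eq_zero fun b _ => hpt b

/-- Integration over fibres: the Euler characteristic of the fibre over `x` is the indicator at `x`
of the projection, so the one-dimensional case applies to the fibres and then to the projections. -/
theorem sum_convexEuler_eq_zero_prod (s : Finset ι) (n : ι → ℤ) (K : ι → Set (ℝ × ℝ))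
    (hc : ∀ i ∈ s, Convex ℝ (K i)) (hk : ∀ i ∈ s, IsCompact (K i))
    (h : ∀ x, ∑ i ∈ s, n i * (K i).indicator (fun _ => (1 : ℤ)) x = 0) :
    ∑ i ∈ s, n i * convexEuler (K i) = 0 := by
  classical
  have hfib : ∀ x : ℝ, ∑ i ∈ s, n i * convexEuler (Prod.mk x ⁻¹' K i) = 0 := by
    intro x
    refine sum_convexEuler_eq_zero_real s n _ (fun i hi => ?_) (fun i hi => ?_) (fun y => ?_)
    · intro y hy z hz a b ha hb hab
      have := hc i hi hy hz ha hb hab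
      have e : a • (x, y) + b • (x, z) = (x, a • y + b • z) := by
        ext <;> simp [← add_mul, hab]
      rw [e] at this
      exact this
    · refine ((hk i hi).image continuous_snd).of_isClosed_subset
        ((hk i hi).isClosed.preimage (by fun_prop)) fun y hy => ⟨(x, y), hy, rfl⟩
    · simpa [Set.indicator_apply] using h (x, y)
  have := sum_convexEuler_eq_zero_real s n (fun i => Prod.fst '' K i)
    (fun i hi => (hc i hi).linear_image (LinearMap.fst ℝ ℝ ℝ))
    (fun i hi => (hk i hi).image continuous_fst) (fun x => by
      rw [← hfib x]
      refine Finset.sum_congr rfl fun i _ => ?_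
      rw [convexEuler_eq_indicator (x := x) (T := Prod.fst '' K i)]
      constructor
      · rintro ⟨y, hy⟩
        exact ⟨(x, y), hy, rfl⟩
      · rintro ⟨⟨_, y⟩, hy, rfl⟩
        exact ⟨y, hy⟩)
  simpa only [convexEuler_image] using this

variable {V : Type*} [NormedAddCommGroup V] [InnerProductSpace ℝ V]

theorem sum_convexEuler_eq_zero [FiniteDimensional ℝ V] (hV : Module.finrank ℝ V = 2)
    (s : Finset ι) (n : ι → ℤ) (K : ι → Set V)
    (hc : ∀ i ∈ s, Convex ℝ (K i)) (hk : ∀ i ∈ s, IsCompact (K i))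
    (h : ∀ x, ∑ i ∈ s, n i * (K i).indicator (fun _ => (1 : ℤ)) x = 0) :
    ∑ i ∈ s, n i * convexEuler (K i) = 0 := by
  let e : V ≃L[ℝ] ℝ × ℝ := ContinuousLinearEquiv.ofFinrankEq (by simp [hV])
  have := sum_convexEuler_eq_zero_prod s n (fun i => e '' K i)
    (fun i hi => (hc i hi).linear_image (e : V →ₗ[ℝ] ℝ × ℝ))
    (fun i hi => (hk i hi).image e.continuous) (fun x => by
      rw [← h (e.symm x)]
      refine Finset.sum_congr rfl fun i _ => ?_
      classical
      rw [Set.indicator_apply, Set.indicator_apply]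
      congr 2
      exact propext ⟨fun ⟨y, hy, hyx⟩ => by simpa [← hyx] using hy,
        fun hx => ⟨_, hx, e.apply_symm_apply x⟩⟩)
  simpa only [convexEuler_image] using this

theorem mem_add_closedBall_iff {W : Type*} [NormedAddCommGroup W] (C : Set W) (ρ : ℝ) (x : W) :
    x ∈ C + Metric.closedBall (0 : W) ρ ↔ (C ∩ Metric.closedBall x ρ).Nonempty := by
  rw [Set.mem_add]
  constructor
  · rintro ⟨c, hc, b, hb, rfl⟩
    refine ⟨c, hc, ?_⟩
    simpa [dist_eq_norm] using hb
  · rintro ⟨c, hc, hb⟩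
    refine ⟨c, hc, x - c, ?_, by simp⟩
    rw [Metric.mem_closedBall, dist_comm, dist_eq_norm] at hb
    simpa using hb

theorem IsPolytope.isCompact {C : Set V} (hC : IsPolytope C) : IsCompact C := by
  obtain ⟨s, hs, rfl⟩ := hC
  exact hs.isCompact_convexHull ℝ

/-- The linear combination of indicator functions given by a formal combination of polytopes. -/
noncomputable def polytopeIndicator : FreeAbelianGroup (Polytope V) →+ (V → ℤ) :=
  FreeAbelianGroup.lift fun C => C.1.indicator fun _ => 1

variable [FiniteDimensional ℝ V] [MeasurableSpace V] [BorelSpace V]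

/-- The volume of the parallel body of a set. -/
noncomputable def parallelVolume (ρ : ℝ) (C : Set V) : ℝ :=
  volume.real (C + Metric.closedBall (0 : V) ρ)

/-- A point `x` lies in the parallel body exactly when `closedBall x ρ` meets the set. An indicator
relation survives intersection with this ball, so the Euler characteristics cancel for each `x`, and
then the integrals do. -/
theorem sum_parallelVolume_eq_zero (hV : Module.finrank ℝ V = 2)
    (s : Finset ι) (n : ι → ℤ) (K : ι → Set V)
    (hc : ∀ i ∈ s, Convex ℝ (K i)) (hk : ∀ i ∈ s, IsCompact (K i))
    (h : ∀ x, ∑ i ∈ s, n i * (K i).indicator (fun _ => (1 : ℤ)) x = 0) (ρ : ℝ) :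
    ∑ i ∈ s, n i • parallelVolume ρ (K i) = 0 := by
  have hcpt : ∀ i ∈ s, IsCompact (K i + Metric.closedBall (0 : V) ρ) := fun i hi =>
    (hk i hi).add (isCompact_closedBall 0 ρ)
  have hint : ∀ i ∈ s, Integrable (fun x => (n i : ℝ) *
      (K i + Metric.closedBall (0 : V) ρ).indicator (fun _ => (1 : ℝ)) x) := fun i hi =>
    (((integrable_indicator_iff (hcpt i hi).measurableSet).2
      (integrableOn_const (hcpt i hi).measure_lt_top.ne))).const_mul _
  have hvol : ∀ i ∈ s, n i • parallelVolume ρ (K i) = ∫ x, (n i : ℝ) *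
      (K i + Metric.closedBall (0 : V) ρ).indicator (fun _ => (1 : ℝ)) x := fun i hi => by
    rw [integral_const_mul, integral_indicator (hcpt i hi).measurableSet]
    simp [parallelVolume]
  rw [Finset.sum_congr rfl hvol, ← integral_finsetSum s hint]
  refine integral_eq_zero_of_ae (Eventually.of_forall fun x => ?_)
  have key := sum_convexEuler_eq_zero hV s n (fun i => K i ∩ Metric.closedBall x ρ)
    (fun i hi => (hc i hi).inter (convex_closedBall x ρ))
    (fun i hi => (hk i hi).inter (isCompact_closedBall x ρ)) (fun y => by
      classical
      have hy := h y
      by_cases hyx : y ∈ Metric.closedBall x ρ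
      · rw [← hy]
        refine Finset.sum_congr rfl fun i _ => ?_
        simp only [Set.indicator_apply, Set.mem_inter_iff, hyx, and_true]
      · refine Finset.sum_eq_zero fun i _ => ?_
        simp only [Set.indicator_apply, Set.mem_inter_iff, hyx, and_false, if_false, mul_zero])
  have hcast : ((∑ i ∈ s, n i * convexEuler (K i ∩ Metric.closedBall x ρ) : ℤ) : ℝ) = 0 := by
    rw [key, Int.cast_zero]
  push_cast at hcast
  rw [Pi.zero_apply, ← hcast]
  refine Finset.sum_congr rfl fun i _ => ?_
  rw [convexEuler_eq_indicator (mem_add_closedBall_iff (K i) ρ x).symm]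
  classical
  simp only [Set.indicator_apply]
  split_ifs <;> simp

/-- The volumes of parallel bodies as a homomorphism on formal combinations of polytopes. -/
noncomputable def freeParallelVolume (ρ : ℝ) : FreeAbelianGroup (Polytope V) →+ ℝ :=
  FreeAbelianGroup.lift fun C => parallelVolume ρ C.1

theorem freeParallelVolume_eq_zero (hV : Module.finrank ℝ V = 2) (ρ : ℝ)
    {a : FreeAbelianGroup (Polytope V)} (ha : polytopeIndicator a = 0) :
    freeParallelVolume ρ a = 0 := by
  have hrep := a.eq_sum_support_coeff_smul_of
  have h1 : freeParallelVolume ρ a =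
      ∑ C ∈ a.support, FreeAbelianGroup.coeff C a • parallelVolume ρ C.1 := by
    conv_lhs => rw [hrep]
    simp [map_sum, freeParallelVolume]
  rw [h1]
  refine sum_parallelVolume_eq_zero hV a.support _ (fun C : Polytope V => C.1)
    (fun C _ => IsFiniteHull.convex C.2) (fun C _ => IsPolytope.isCompact C.2) (fun x => ?_) ρ
  have hx := congr_fun ha x
  rw [hrep] at hx
  simpa [map_sum, polytopeIndicator, Finset.sum_apply] using hx

theorem parallelVolume_image (g : V ≃ᵃⁱ[ℝ] V) (ρ : ℝ) (C : Set V) :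
    parallelVolume ρ (g '' C) = parallelVolume ρ C := by
  have hlin : ∀ x, g x = g.linearIsometryEquiv x + g 0 := fun x => by
    have := g.map_vadd 0 x
    simpa using this
  have himg : g '' C + Metric.closedBall (0 : V) ρ = g '' (C + Metric.closedBall (0 : V) ρ) := by
    ext x
    obtain ⟨y, rfl⟩ := g.surjective x
    rw [mem_add_closedBall_iff, g.injective.mem_set_image, mem_add_closedBall_iff]
    constructor
    · rintro ⟨_, ⟨c, hc, rfl⟩, h⟩
      refine ⟨c, hc, ?_⟩
      simpa using h
    · rintro ⟨c, hc, h⟩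
      exact ⟨g c, ⟨c, hc, rfl⟩, by simpa using h⟩
  have hcomp : (g : V → V) = (fun x => x + g 0) ∘ g.linearIsometryEquiv := funext hlin
  have hpre : ∀ S : Set V, volume (g '' S) = volume S := fun S => by
    rw [hcomp, Set.image_comp, Set.image_add_right, measure_preimage_add_right,
      LinearIsometryEquiv.image_eq_preimage_symm]
    exact (g.linearIsometryEquiv.symm.measurePreserving).measure_preimage_equiv
      (f := g.linearIsometryEquiv.symm.toMeasurableEquiv) S
  rw [parallelVolume, himg, measureReal_def, hpre]
  rfl

/-- The volumes of parallel bodies as a homomorphism on the dissection group. -/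
noncomputable def dissectionParallelVolume (hV : Module.finrank ℝ V = 2) (ρ : ℝ) :
    DissectionGroup V →+ ℝ :=
  QuotientAddGroup.lift _ (freeParallelVolume ρ) (by
    rw [AddSubgroup.closure_le]
    intro a ha
    classical
    cases ha with
    | empty E hE =>
      refine freeParallelVolume_eq_zero hV ρ ?_
      simp [polytopeIndicator, hE]
      rfl
    | union C D U I hU hI =>
      refine freeParallelVolume_eq_zero hV ρ ?_
      funext x
      simp only [polytopeIndicator, map_sub, map_add, FreeAbelianGroup.lift_apply_of, hU, hI,
        Pi.sub_apply, Pi.add_apply, Pi.zero_apply, Set.indicator_apply, Set.mem_union,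
        Set.mem_inter_iff]
      by_cases h1 : x ∈ C.1 <;> by_cases h2 : x ∈ D.1 <;> simp [h1, h2]
    | isometry C D g hD =>
      simp [freeParallelVolume, hD, parallelVolume_image])

@[simp]
theorem dissectionParallelVolume_polytopeClass (hV : Module.finrank ℝ V = 2) (ρ : ℝ)
    (C : Polytope V) :
    dissectionParallelVolume hV ρ (polytopeClass C) = parallelVolume ρ C.1 := by
  simp [dissectionParallelVolume, polytopeClass, freeParallelVolume]

end EulerCharacteristic

/-! ### Classes of segments, parallelograms and triangles. -/

section DissectionClasses

open Set

variable {V : Type*} [NormedAddCommGroup V] [InnerProductSpace ℝ V]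

open Classical in
/-- The class of a set in the dissection group (`0` if it is not a polytope). -/
noncomputable def setClass (C : Set V) : DissectionGroup V :=
  if h : IsPolytope C then polytopeClass ⟨C, h⟩ else 0

theorem setClass_val (C : Polytope V) : setClass C.1 = polytopeClass C :=
  dif_pos C.2

theorem mk_eq_zero_of_dissectionRel {a : FreeAbelianGroup (Polytope V)} (h : DissectionRel a) :
    (QuotientAddGroup.mk a : DissectionGroup V) = 0 :=
  (QuotientAddGroup.eq_zero_iff a).2 (AddSubgroup.subset_closure h)

theorem setClass_empty : setClass (∅ : Set V) = 0 := by
  have h : IsPolytope (∅ : Set V) := isFiniteHull_empty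
  refine (setClass_val ⟨∅, h⟩).trans ?_
  exact mk_eq_zero_of_dissectionRel (.empty _ rfl)

theorem setClass_union_add_inter [FiniteDimensional ℝ V] {C D : Set V} (hC : IsFiniteHull C)
    (hD : IsFiniteHull D) (hU : IsFiniteHull (C ∪ D)) :
    setClass (C ∪ D) + setClass (C ∩ D) = setClass C + setClass D := by
  have hI : IsFiniteHull (C ∩ D) := hC.inter hD
  have := mk_eq_zero_of_dissectionRel
    (.union ⟨C, hC⟩ ⟨D, hD⟩ ⟨C ∪ D, hU⟩ ⟨C ∩ D, hI⟩ rfl rfl : DissectionRel (V := V) _)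
  rw [QuotientAddGroup.mk_sub, QuotientAddGroup.mk_add, QuotientAddGroup.mk_add, sub_eq_zero]
    at this
  exact (congrArg₂ (· + ·) (setClass_val ⟨C ∪ D, hU⟩) (setClass_val ⟨C ∩ D, hI⟩)).trans
    (this.trans (congrArg₂ (· + ·) (setClass_val ⟨C, hC⟩) (setClass_val ⟨D, hD⟩)).symm)

theorem setClass_image (g : V ≃ᵃⁱ[ℝ] V) {C : Set V} (hC : IsFiniteHull C) :
    setClass (g '' C) = setClass C := by
  have hD : IsFiniteHull (g '' C) := hC.image g.toAffineEquiv.toAffineMap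
  have := mk_eq_zero_of_dissectionRel
    (.isometry ⟨C, hC⟩ ⟨g '' C, hD⟩ g rfl : DissectionRel (V := V) _)
  rw [QuotientAddGroup.mk_sub, sub_eq_zero] at this
  exact (setClass_val ⟨g '' C, hD⟩).trans (this.trans (setClass_val ⟨C, hC⟩).symm)

theorem setClass_add_left (a : V) {C : Set V} (hC : IsFiniteHull C) :
    setClass ((fun x => a + x) '' C) = setClass C :=
  setClass_image (AffineIsometryEquiv.constVAdd ℝ V a) hC

theorem setClass_sub_left (a : V) {C : Set V} (hC : IsFiniteHull C) :
    setClass ((fun x => a - x) '' C) = setClass C :=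
  setClass_image (AffineIsometryEquiv.constVSub ℝ a) hC

/-- The class of a point. -/
noncomputable def pointClass (V : Type*) [NormedAddCommGroup V] [InnerProductSpace ℝ V] :
    DissectionGroup V := setClass ({0} : Set V)

theorem setClass_singleton (x : V) : setClass ({x} : Set V) = pointClass V := by
  have := setClass_add_left x (isFiniteHull_singleton (0 : V))
  rwa [image_singleton, add_zero] at this

/-- The class of a segment with direction vector `u`. -/
noncomputable def segmentClass (u : V) : DissectionGroup V := setClass (segment ℝ 0 u)

theorem setClass_segment (x y : V) : setClass (segment ℝ x y) = segmentClass (y - x) := by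
  have := setClass_add_left x (isFiniteHull_segment (0 : V) (y - x))
  rwa [segment_translate_image, add_zero, add_sub_cancel] at this

/-- The reflection in the hyperplane orthogonal to `u - v` takes `u` to `v`. -/
theorem segmentClass_of_norm_eq [FiniteDimensional ℝ V] {u v : V} (h : ‖u‖ = ‖v‖) :
    segmentClass u = segmentClass v := by
  let g := (Submodule.reflection (Submodule.span ℝ {u - v})ᗮ).toAffineIsometryEquiv
  have hu : g u = v := Submodule.reflection_sub h
  have h0 : g 0 = 0 := map_zero (Submodule.reflection (Submodule.span ℝ {u - v})ᗮ)
  have h := setClass_image g (isFiniteHull_segment (0 : V) u)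
  have himg : g '' segment ℝ 0 u = segment ℝ (g 0) (g u) :=
    image_segment ℝ g.toAffineEquiv.toAffineMap 0 u
  rw [himg, hu, h0] at h
  exact h.symm

/-- The linear map with the columns `u` and `v`. -/
noncomputable def planeMap (u v : V) : ℝ × ℝ →ₗ[ℝ] V :=
  (LinearMap.fst ℝ ℝ ℝ).smulRight u + (LinearMap.snd ℝ ℝ ℝ).smulRight v

theorem planeMap_apply (u v : V) (p : ℝ × ℝ) : planeMap u v p = p.1 • u + p.2 • v := rfl

theorem planeMap_injective {u v : V} (h : LinearIndependent ℝ ![u, v]) :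
    Function.Injective (planeMap u v) := by
  rw [← LinearMap.ker_eq_bot, LinearMap.ker_eq_bot']
  rintro ⟨x, y⟩ hxy
  have := LinearIndependent.pair_iff.1 h x y hxy
  ext <;> simp [this]

theorem IsFiniteHull.planeMap {S : Set (ℝ × ℝ)} (hS : IsFiniteHull S) (u v : V) :
    IsFiniteHull (planeMap u v '' S) :=
  hS.image (_root_.planeMap u v).toAffineMap

theorem isFiniteHull_box {a b c d : ℝ} (hab : a ≤ b) (hcd : c ≤ d) :
    IsFiniteHull (Icc a b ×ˢ Icc c d : Set (ℝ × ℝ)) := by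
  rw [← segment_eq_Icc hab, ← segment_eq_Icc hcd]
  exact (isFiniteHull_segment a b).prod (isFiniteHull_segment c d)

theorem IsFiniteHull.cut {S : Set (ℝ × ℝ)} (hS : IsFiniteHull S) (α β k : ℝ) :
    IsFiniteHull (S ∩ {p | p.1 * α + p.2 * β ≤ k}) :=
  hS.inter_ge (_root_.planeMap α β) k

/-- The class of the planar set with coordinate description `S` with respect to `u` and `v`. -/
noncomputable def coordClass (u v : V) (S : Set (ℝ × ℝ)) : DissectionGroup V :=
  setClass (planeMap u v '' S)

theorem coordClass_union_add_inter [FiniteDimensional ℝ V] {u v : V}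
    (h : LinearIndependent ℝ ![u, v]) {S T U I : Set (ℝ × ℝ)} (hS : IsFiniteHull S)
    (hT : IsFiniteHull T) (hU : IsFiniteHull U) (hSU : S ∪ T = U) (hSI : S ∩ T = I) :
    coordClass u v U + coordClass u v I = coordClass u v S + coordClass u v T := by
  subst hSU hSI
  have := hU.planeMap u v
  rw [image_union] at this
  rw [coordClass, coordClass, image_union, image_inter (planeMap_injective h),
    setClass_union_add_inter (hS.planeMap u v) (hT.planeMap u v) this]
  rfl

theorem coordClass_add_left (u v : V) (a : ℝ × ℝ) {S T : Set (ℝ × ℝ)} (hS : IsFiniteHull S)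
    (h : (fun p => a + p) '' S = T) : coordClass u v T = coordClass u v S := by
  subst h
  rw [coordClass, image_image, coordClass, ← setClass_add_left (planeMap u v a) (hS.planeMap u v),
    image_image]
  simp only [map_add]

theorem coordClass_sub_left (u v : V) (a : ℝ × ℝ) {S T : Set (ℝ × ℝ)} (hS : IsFiniteHull S)
    (h : (fun p => a - p) '' S = T) : coordClass u v T = coordClass u v S := by
  subst h
  rw [coordClass, image_image, coordClass, ← setClass_sub_left (planeMap u v a) (hS.planeMap u v),
    image_image]
  simp only [map_sub]

theorem coordClass_segment (u v : V) (p q : ℝ × ℝ) :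
    coordClass u v (segment ℝ p q) = segmentClass (planeMap u v (q - p)) := by
  rw [coordClass, map_sub, ← setClass_segment]
  exact congrArg setClass (image_segment ℝ (planeMap u v).toAffineMap p q)

/-- The class of the parallelogram spanned by `u` and `v`. -/
noncomputable def parallelogramClass (u v : V) : DissectionGroup V :=
  coordClass u v (Icc 0 1 ×ˢ Icc 0 1)

/-- The class of the half-open parallelogram spanned by `u` and `v`. -/
noncomputable def openParallelogramClass (u v : V) : DissectionGroup V :=
  parallelogramClass u v - segmentClass u - segmentClass v + pointClass V

theorem mem_segment_prod_iff {p q z : ℝ × ℝ} : z ∈ segment ℝ p q ↔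
    ∃ t, 0 ≤ t ∧ t ≤ 1 ∧ z.1 = p.1 + t * (q.1 - p.1) ∧ z.2 = p.2 + t * (q.2 - p.2) := by
  rw [segment_eq_image']
  simp only [mem_image, mem_Icc, Prod.ext_iff, and_assoc, Prod.fst_add, Prod.smul_fst,
    Prod.fst_sub, smul_eq_mul, Prod.snd_add, Prod.smul_snd, Prod.snd_sub, eq_comm]

/-- The trapezoid `0 ≤ x ≤ 1 + ty`, `0 ≤ y ≤ 1` splits in two ways: into the unit square and a
triangle on its right, or into the sheared parallelogram and a triangle on its left. The two
triangles are translates of each other, and the overlaps are segments along `v` and `v + t • u`. -/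
theorem parallelogramClass_add_smul [FiniteDimensional ℝ V] {u v : V}
    (h : LinearIndependent ℝ ![u, v]) {t : ℝ} (ht : 0 ≤ t) :
    parallelogramClass u (v + t • u) + segmentClass v
      = parallelogramClass u v + segmentClass (v + t • u) := by
  have hb : ∀ y : ℝ, 0 ≤ y → y ≤ 1 → 0 ≤ y * t ∧ y * t ≤ t := fun y h0 h1 =>
    ⟨by positivity, by nlinarith⟩
  have hP : IsFiniteHull (Icc 0 1 ×ˢ Icc 0 1 : Set (ℝ × ℝ)) :=
    isFiniteHull_box zero_le_one zero_le_one
  have hZ := (isFiniteHull_box (show 0 ≤ 1 + t by linarith) zero_le_one).cut 1 (-t) 1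
  have hR := (isFiniteHull_box (show 1 ≤ 1 + t by linarith) zero_le_one).cut 1 (-t) 1
  have hL := (isFiniteHull_box ht zero_le_one).cut 1 (-t) 0
  have hQ := hZ.cut (-1) t 0
  have e1 := coordClass_union_add_inter h hP hR hZ (I := segment ℝ (1, 0) (1, 1)) (by
    ext ⟨x, y⟩
    simp only [mem_union, mem_inter_iff, mem_prod, mem_Icc, mem_ofPred_eq]
    have := hb y
    grind) (by
    ext ⟨x, y⟩
    simp only [mem_inter_iff, mem_prod, mem_Icc, mem_ofPred_eq, mem_segment_prod_iff]
    constructor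
    · rintro ⟨⟨_, h2⟩, ⟨_, _⟩, _⟩
      exact ⟨y, by linarith, by linarith, by linarith, by linarith⟩
    · rintro ⟨s, h0, h1, rfl, rfl⟩
      have := hb s h0 h1
      refine ⟨⟨⟨?_, ?_⟩, ?_, ?_⟩, ⟨⟨?_, ?_⟩, ?_, ?_⟩, ?_⟩ <;> linarith)
  have e2 := coordClass_union_add_inter h hL hQ hZ (I := segment ℝ (0, 0) (t, 1)) (by
    ext ⟨x, y⟩
    simp only [mem_union, mem_inter_iff, mem_prod, mem_Icc, mem_ofPred_eq]
    have := hb y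
    grind) (by
    ext ⟨x, y⟩
    simp only [mem_inter_iff, mem_prod, mem_Icc, mem_ofPred_eq, mem_segment_prod_iff]
    constructor
    · rintro ⟨⟨⟨_, _⟩, _⟩, ⟨⟨_, _⟩, _⟩, _⟩
      exact ⟨y, by linarith, by linarith, by linarith, by linarith⟩
    · rintro ⟨s, h0, h1, rfl, rfl⟩
      have := hb s h0 h1
      refine ⟨⟨⟨⟨?_, ?_⟩, ?_, ?_⟩, ?_⟩, ⟨⟨⟨?_, ?_⟩, ?_, ?_⟩, ?_⟩, ?_⟩ <;> linarith)
  have e3 := coordClass_add_left u v (1, 0) hL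
    (T := Icc 1 (1 + t) ×ˢ Icc 0 1 ∩ {p | p.1 * 1 + p.2 * -t ≤ 1}) (by
    ext ⟨x, y⟩
    simp only [mem_image, mem_inter_iff, mem_prod, mem_Icc, mem_ofPred_eq, Prod.exists,
      Prod.mk_add_mk, Prod.mk.injEq]
    constructor
    · rintro ⟨x, y, ⟨⟨⟨_, _⟩, _, _⟩, _⟩, rfl, rfl⟩
      refine ⟨⟨⟨?_, ?_⟩, ?_, ?_⟩, ?_⟩ <;> linarith
    · rintro ⟨⟨⟨_, _⟩, _, _⟩, _⟩
      refine ⟨x - 1, y, ⟨⟨⟨?_, ?_⟩, ?_, ?_⟩, ?_⟩, ?_, ?_⟩ <;> linarith)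
  have e4 : parallelogramClass u (v + t • u) = coordClass u v
      (((Icc 0 (1 + t) ×ˢ Icc 0 1) ∩ {p | p.1 * 1 + p.2 * -t ≤ 1}) ∩
        {p | p.1 * -1 + p.2 * t ≤ 0}) := by
    rw [parallelogramClass, coordClass, coordClass]
    congr 1
    ext z
    simp only [mem_image, mem_inter_iff, mem_prod, mem_Icc, mem_ofPred_eq, Prod.exists,
      planeMap_apply]
    constructor
    · rintro ⟨x, y, ⟨⟨_, _⟩, h0, h1⟩, rfl⟩
      have := hb y h0 h1
      refine ⟨x + y * t, y, ⟨⟨⟨⟨?_, ?_⟩, ?_, ?_⟩, ?_⟩, ?_⟩, by module⟩ <;> linarith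
    · rintro ⟨x, y, ⟨⟨⟨⟨_, _⟩, h0, h1⟩, _⟩, _⟩, rfl⟩
      refine ⟨x - y * t, y, ⟨⟨?_, ?_⟩, ?_, ?_⟩, by module⟩ <;> linarith
  rw [coordClass_segment] at e1 e2
  have s1 : planeMap u v ((1, 1) - (1, 0)) = v := by simp [planeMap_apply]
  have s2 : planeMap u v ((t, 1) - (0, 0)) = v + t • u := by simp [planeMap_apply, add_comm]
  rw [s1, e3] at e1
  rw [s2, ← e4] at e2
  have e5 : coordClass u v (Icc 0 1 ×ˢ Icc 0 1) = parallelogramClass u v := rfl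
  rw [e5] at e1
  generalize coordClass u v (Icc 0 t ×ˢ Icc 0 1 ∩ {p | p.1 * 1 + p.2 * -t ≤ 0}) = l at e1 e2
  generalize coordClass u v (Icc 0 (1 + t) ×ˢ Icc 0 1 ∩ {p | p.1 * 1 + p.2 * -t ≤ 1}) = z at e1 e2
  have h1 : parallelogramClass u v = z + segmentClass v - l := by rw [e1]; abel
  have h2 : parallelogramClass u (v + t • u) = z + segmentClass (v + t • u) - l := by
    rw [e2]; abel
  rw [h1, h2]
  abel

theorem openParallelogramClass_add_smul [FiniteDimensional ℝ V] {u v : V}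
    (h : LinearIndependent ℝ ![u, v]) (t : ℝ) :
    openParallelogramClass u (v + t • u) = openParallelogramClass u v := by
  have key : ∀ {v : V} {t : ℝ}, LinearIndependent ℝ ![u, v] → 0 ≤ t →
      openParallelogramClass u (v + t • u) = openParallelogramClass u v := by
    intro v t h ht
    have := parallelogramClass_add_smul h ht
    rw [← eq_sub_iff_add_eq] at this
    rw [openParallelogramClass, openParallelogramClass, this]
    abel
  rcases le_total 0 t with ht | ht
  · exact key h ht
  · have h' : LinearIndependent ℝ ![u, v + t • u] := by
      rwa [add_comm, LinearIndependent.pair_add_smul_right_iff]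
    -- For negative `t` the shear by `-t` is applied to the already sheared parallelogram.
    rw [← key h' (neg_nonneg.2 ht)]
    congr 1
    module

theorem openParallelogramClass_comm (u v : V) :
    openParallelogramClass u v = openParallelogramClass v u := by
  have : parallelogramClass u v = parallelogramClass v u := by
    rw [parallelogramClass, parallelogramClass, coordClass, coordClass]
    congr 1
    ext z
    simp only [mem_image, mem_prod, mem_Icc, Prod.exists, planeMap_apply]
    constructor <;>
    · rintro ⟨x, y, ⟨hx, hy⟩, rfl⟩
      exact ⟨y, x, ⟨hy, hx⟩, add_comm _ _⟩
  rw [openParallelogramClass, openParallelogramClass, this]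
  abel

theorem openParallelogramClass_neg_left [FiniteDimensional ℝ V] (u v : V) :
    openParallelogramClass (-u) v = openParallelogramClass u v := by
  have hP : IsFiniteHull (Icc 0 1 ×ˢ Icc 0 1 : Set (ℝ × ℝ)) :=
    isFiniteHull_box zero_le_one zero_le_one
  have : parallelogramClass (-u) v = parallelogramClass u v := by
    rw [parallelogramClass, parallelogramClass, coordClass, coordClass,
      ← setClass_add_left (-u) (hP.planeMap u v)]
    congr 1
    ext z
    simp only [mem_image, mem_prod, mem_Icc, Prod.exists, planeMap_apply]
    constructor
    · rintro ⟨x, y, ⟨⟨h0, h1⟩, hy⟩, rfl⟩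
      exact ⟨_, ⟨1 - x, y, ⟨⟨by linarith, by linarith⟩, hy⟩, rfl⟩, by module⟩
    · rintro ⟨_, ⟨x, y, ⟨⟨h0, h1⟩, hy⟩, rfl⟩, rfl⟩
      exact ⟨1 - x, y, ⟨⟨by linarith, by linarith⟩, hy⟩, by module⟩
  rw [openParallelogramClass, openParallelogramClass, this,
    segmentClass_of_norm_eq (norm_neg u)]

theorem openParallelogramClass_map (g : V ≃ₗᵢ[ℝ] V) (u v : V) :
    openParallelogramClass (g u) (g v) = openParallelogramClass u v := by
  have hP : IsFiniteHull (Icc 0 1 ×ˢ Icc 0 1 : Set (ℝ × ℝ)) :=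
    isFiniteHull_box zero_le_one zero_le_one
  have hs : ∀ w : V, segmentClass (g w) = segmentClass w := fun w => by
    have h := setClass_image g.toAffineIsometryEquiv (isFiniteHull_segment (0 : V) w)
    have himg : g.toAffineIsometryEquiv '' segment ℝ 0 w = segment ℝ (g 0) (g w) :=
      image_segment ℝ g.toAffineIsometryEquiv.toAffineEquiv.toAffineMap 0 w
    rw [himg, map_zero] at h
    exact h
  have : parallelogramClass (g u) (g v) = parallelogramClass u v := by
    rw [parallelogramClass, parallelogramClass, coordClass, coordClass,
      ← setClass_image g.toAffineIsometryEquiv (hP.planeMap u v), image_image]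
    congr 1
    refine image_congr fun p _ => ?_
    simp [planeMap_apply]
  rw [openParallelogramClass, openParallelogramClass, this, hs, hs]

/-- Three shears carry `(u, v)` to `(-s • v, s⁻¹ • u)`, by way of `(u, v + s⁻¹ • u)` and `(-s • v, v
+ s⁻¹ • u)`. The sign drops out, and applying this to `(v, u)` gives the claim. -/
theorem openParallelogramClass_inv_smul [FiniteDimensional ℝ V] {u v : V}
    (h : LinearIndependent ℝ ![u, v]) {s : ℝ} (hs : s ≠ 0) :
    openParallelogramClass (s • u) (s⁻¹ • v) = openParallelogramClass u v := by
  have key : ∀ {u v : V}, LinearIndependent ℝ ![u, v] →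
      openParallelogramClass (s • v) (s⁻¹ • u) = openParallelogramClass u v := by
    intro u v h
    have h1 : LinearIndependent ℝ ![u, v + s⁻¹ • u] := by
      rwa [add_comm, LinearIndependent.pair_add_smul_right_iff]
    have h1' := LinearIndependent.pair_symm_iff.1 h1
    have e3 : u + -s • (v + s⁻¹ • u) = -(s • v) := by
      rw [smul_add, smul_smul, neg_mul, mul_inv_cancel₀ hs]; module
    have e5 : v + s⁻¹ • u + s⁻¹ • -(s • v) = s⁻¹ • u := by
      rw [smul_neg, smul_smul, inv_mul_cancel₀ hs]; module
    have h2 : LinearIndependent ℝ ![-(s • v), v + s⁻¹ • u] := by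
      rw [← e3, LinearIndependent.pair_add_smul_left_iff]; exact h1
    rw [← openParallelogramClass_neg_left, ← e5, openParallelogramClass_add_smul h2, ← e3,
      openParallelogramClass_comm, openParallelogramClass_add_smul h1',
      openParallelogramClass_comm, openParallelogramClass_add_smul h]
  rw [key (LinearIndependent.pair_symm_iff.1 h), openParallelogramClass_comm]

theorem segmentClass_add_smul [FiniteDimensional ℝ V] {u : V} (hu : u ≠ 0) {x y : ℝ} (hx : 0 ≤ x)
    (hy : 0 ≤ y) :
    segmentClass ((x + y) • u) + pointClass V = segmentClass (x • u) + segmentClass (y • u) := by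
  have himg : ∀ a b : ℝ, a ≤ b → (fun t : ℝ => t • u) '' Icc a b = segment ℝ (a • u) (b • u) := by
    intro a b hab
    rw [← segment_eq_Icc hab]
    exact image_segment ℝ (LinearMap.toSpanSingleton ℝ V u).toAffineMap a b
  have hinj : Function.Injective fun t : ℝ => t • u := smul_left_injective ℝ hu
  have hun : segment ℝ 0 (x • u) ∪ segment ℝ (x • u) ((x + y) • u) =
      segment ℝ 0 ((x + y) • u) := by
    rw [← zero_smul ℝ u, ← himg _ _ hx, ← himg _ _ (by linarith), ← himg _ _ (by linarith),
      ← image_union, Icc_union_Icc_eq_Icc hx (by linarith)]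
  have hin : segment ℝ 0 (x • u) ∩ segment ℝ (x • u) ((x + y) • u) = {x • u} := by
    rw [← zero_smul ℝ u, ← himg _ _ hx, ← himg _ _ (by linarith),
      ← image_inter hinj, Icc_inter_Icc_eq_singleton hx (by linarith), image_singleton]
  have := setClass_union_add_inter (isFiniteHull_segment 0 (x • u))
    (isFiniteHull_segment (x • u) ((x + y) • u)) (by rw [hun]; exact isFiniteHull_segment _ _)
  rw [hun, hin, setClass_singleton, setClass_segment (x • u), add_smul, add_sub_cancel_left,
    ← add_smul] at this
  exact this

theorem parallelogramClass_smul_left (u v : V) {x : ℝ} (hx : 0 ≤ x) :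
    parallelogramClass (x • u) v = coordClass u v (Icc 0 x ×ˢ Icc 0 1) := by
  rw [parallelogramClass, coordClass, coordClass]
  congr 1
  ext z
  simp only [mem_image, mem_prod, mem_Icc, Prod.exists, planeMap_apply]
  constructor
  · rintro ⟨a, b, ⟨⟨h0, h1⟩, hb⟩, rfl⟩
    exact ⟨a * x, b, ⟨⟨by positivity, by nlinarith⟩, hb⟩, by module⟩
  · rintro ⟨a, b, ⟨⟨h0, h1⟩, hb⟩, rfl⟩
    rcases hx.eq_or_lt with rfl | hx
    · obtain rfl : a = 0 := le_antisymm h1 h0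
      exact ⟨0, b, ⟨⟨le_rfl, zero_le_one⟩, hb⟩, by module⟩
    · refine ⟨a / x, b, ⟨⟨by positivity, (div_le_one hx).2 h1⟩, hb⟩, ?_⟩
      rw [smul_smul, div_mul_cancel₀ _ hx.ne']

theorem openParallelogramClass_add_smul_left [FiniteDimensional ℝ V] {u v : V}
    (h : LinearIndependent ℝ ![u, v]) {x y : ℝ} (hx : 0 ≤ x) (hy : 0 ≤ y) :
    openParallelogramClass ((x + y) • u) v
      = openParallelogramClass (x • u) v + openParallelogramClass (y • u) v := by
  have hxy : x ≤ x + y := by linarith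
  have e1 := coordClass_union_add_inter h (isFiniteHull_box hx zero_le_one)
    (isFiniteHull_box hxy zero_le_one) (isFiniteHull_box (hx.trans hxy) zero_le_one)
    (I := segment ℝ (x, 0) (x, 1)) (by
      rw [← union_prod, Icc_union_Icc_eq_Icc hx hxy]) (by
      rw [← inter_prod, Icc_inter_Icc_eq_singleton hx hxy]
      ext ⟨a, b⟩
      simp only [mem_prod, mem_singleton_iff, mem_Icc, mem_segment_prod_iff]
      constructor
      · rintro ⟨rfl, h0, h1⟩
        exact ⟨b, h0, h1, by ring, by ring⟩
      · rintro ⟨t, h0, h1, rfl, rfl⟩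
        refine ⟨?_, ?_, ?_⟩ <;> linarith)
  have e2 := coordClass_add_left u v (x, 0) (isFiniteHull_box hy zero_le_one)
    (T := Icc x (x + y) ×ˢ Icc 0 1) (by
      ext ⟨a, b⟩
      simp only [mem_image, mem_prod, mem_Icc, Prod.exists, Prod.mk_add_mk, Prod.mk.injEq]
      constructor
      · rintro ⟨a, b, ⟨⟨_, _⟩, _, _⟩, rfl, rfl⟩
        refine ⟨⟨?_, ?_⟩, ?_, ?_⟩ <;> linarith
      · rintro ⟨⟨_, _⟩, _, _⟩
        refine ⟨a - x, b, ⟨⟨?_, ?_⟩, ?_, ?_⟩, ?_, ?_⟩ <;> linarith)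
  have s1 : planeMap u v ((x, 1) - (x, 0)) = v := by simp [planeMap_apply]
  rw [coordClass_segment, s1, e2, ← parallelogramClass_smul_left u v hx,
    ← parallelogramClass_smul_left u v hy, ← parallelogramClass_smul_left u v (hx.trans hxy)] at e1
  have hu : u ≠ 0 := h.ne_zero 0
  have e3 := segmentClass_add_smul hu hx hy
  rw [← eq_sub_iff_add_eq] at e1 e3
  rw [openParallelogramClass, openParallelogramClass, openParallelogramClass, e1, e3]
  abel

/-- The class of the triangle spanned by `u` and `v`. -/
noncomputable def triangleClass (u v : V) : DissectionGroup V :=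
  setClass (convexHull ℝ {0, u, v})

/-- The triangle is cut at half height. The half-turn `p ↦ (1, 1) - p` about the midpoint of the
side opposite the origin moves the upper piece next to the lower trapezoid, filling the
parallelogram on `u` and `v / 2`. The segment terms record the two cuts and the sides missing from
the half-open class. -/
theorem triangleClass_eq [FiniteDimensional ℝ V] {u v : V} (h : LinearIndependent ℝ ![u, v]) :
    triangleClass u v = openParallelogramClass u ((2⁻¹ : ℝ) • v) + segmentClass u
      + segmentClass ((2⁻¹ : ℝ) • v) - pointClass V
      + segmentClass ((2⁻¹ : ℝ) • (v - u)) - segmentClass ((2⁻¹ : ℝ) • u) := by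
  have h2 : (0 : ℝ) ≤ 2⁻¹ := by norm_num
  have hT := (isFiniteHull_box (zero_le_one (α := ℝ)) (zero_le_one (α := ℝ))).cut 1 1 1
  have hA := (isFiniteHull_box zero_le_one (show (2⁻¹ : ℝ) ≤ 1 by norm_num)).cut 1 1 1
  have hB := (isFiniteHull_box zero_le_one h2).cut 1 1 1
  have hC := (isFiniteHull_box zero_le_one h2).cut (-1) (-1) (-1)
  have hR := isFiniteHull_box (zero_le_one (α := ℝ)) h2
  have e1 := coordClass_union_add_inter h hA hB hT (I := segment ℝ (0, 2⁻¹) (2⁻¹, 2⁻¹)) (by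
    ext ⟨x, y⟩
    simp only [mem_union, mem_inter_iff, mem_prod, mem_Icc, mem_ofPred_eq]
    grind) (by
    ext ⟨x, y⟩
    simp only [mem_inter_iff, mem_prod, mem_Icc, mem_ofPred_eq, mem_segment_prod_iff]
    constructor
    · rintro ⟨⟨⟨⟨_, _⟩, _, _⟩, _⟩, ⟨⟨_, _⟩, _, _⟩, _⟩
      exact ⟨2 * x, by linarith, by linarith, by linarith, by linarith⟩
    · rintro ⟨s, h0, h1, rfl, rfl⟩
      refine ⟨⟨⟨⟨?_, ?_⟩, ?_, ?_⟩, ?_⟩, ⟨⟨?_, ?_⟩, ?_, ?_⟩, ?_⟩ <;> linarith)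
  have e2 := coordClass_union_add_inter h hC hB hR (I := segment ℝ (1, 0) (2⁻¹, 2⁻¹)) (by
    ext ⟨x, y⟩
    simp only [mem_union, mem_inter_iff, mem_prod, mem_Icc, mem_ofPred_eq]
    grind) (by
    ext ⟨x, y⟩
    simp only [mem_inter_iff, mem_prod, mem_Icc, mem_ofPred_eq, mem_segment_prod_iff]
    constructor
    · rintro ⟨⟨⟨⟨_, _⟩, _, _⟩, _⟩, ⟨⟨_, _⟩, _, _⟩, _⟩
      exact ⟨2 * y, by linarith, by linarith, by linarith, by linarith⟩
    · rintro ⟨s, h0, h1, rfl, rfl⟩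
      refine ⟨⟨⟨⟨?_, ?_⟩, ?_, ?_⟩, ?_⟩, ⟨⟨?_, ?_⟩, ?_, ?_⟩, ?_⟩ <;> linarith)
  have e3 := coordClass_sub_left u v (1, 1) hA
    (T := Icc 0 1 ×ˢ Icc 0 2⁻¹ ∩ {p | p.1 * -1 + p.2 * -1 ≤ -1}) (by
    ext ⟨x, y⟩
    simp only [mem_image, mem_inter_iff, mem_prod, mem_Icc, mem_ofPred_eq, Prod.exists,
      Prod.mk_sub_mk, Prod.mk.injEq]
    constructor
    · rintro ⟨x, y, ⟨⟨⟨_, _⟩, _, _⟩, _⟩, rfl, rfl⟩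
      refine ⟨⟨⟨?_, ?_⟩, ?_, ?_⟩, ?_⟩ <;> linarith
    · rintro ⟨⟨⟨_, _⟩, _, _⟩, _⟩
      refine ⟨1 - x, 1 - y, ⟨⟨⟨?_, ?_⟩, ?_, ?_⟩, ?_⟩, ?_, ?_⟩ <;> linarith)
  have e4 : coordClass u v (Icc 0 1 ×ˢ Icc 0 1 ∩ {p | p.1 * 1 + p.2 * 1 ≤ 1})
      = triangleClass u v := by
    rw [coordClass, triangleClass]
    have : planeMap u v '' {(0, 0), (1, 0), (0, 1)} = {0, u, v} := by
      simp [image_insert_eq, planeMap_apply]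
    rw [← this]
    refine congrArg setClass (Eq.trans ?_
      ((planeMap u v).image_convexHull {(0, 0), (1, 0), (0, 1)}))
    congr 1
    rw [convexHull_insert (by simp), convexHull_pair]
    ext ⟨x, y⟩
    simp only [mem_inter_iff, mem_prod, mem_Icc, mem_ofPred_eq, mem_convexJoin, mem_singleton_iff,
      exists_eq_left, mem_segment_prod_iff]
    constructor
    · rintro ⟨⟨⟨h0, h1⟩, h2, h3⟩, h4⟩
      rcases (add_nonneg h0 h2).eq_or_lt with hs | hs
      -- At the vertex `0` the radial projection to the opposite side is undefined, and any point of
      -- that side serves.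
      · exact ⟨(1, 0), ⟨0, by norm_num⟩, 0, by norm_num, by norm_num, by simp; linarith,
          by simp; linarith⟩
      · refine ⟨(x / (x + y), y / (x + y)), ⟨y / (x + y), by positivity, ?_, ?_, ?_⟩, x + y,
          hs.le, by linarith, ?_, ?_⟩
        · rw [div_le_one hs]; linarith
        all_goals (simp; try field_simp)
        all_goals ring
    · rintro ⟨⟨a, b⟩, ⟨s, h0, h1, ha, hb⟩, t, h2, h3, hx, hy⟩
      simp only at ha hb hx hy
      subst ha hb hx hy
      refine ⟨⟨⟨?_, ?_⟩, ?_, ?_⟩, ?_⟩ <;> nlinarith [mul_nonneg h0 h2]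
  have e5 : coordClass u v (Icc 0 1 ×ˢ Icc 0 2⁻¹) = parallelogramClass u ((2⁻¹ : ℝ) • v) := by
    rw [parallelogramClass, coordClass, coordClass]
    congr 1
    ext z
    simp only [mem_image, mem_prod, mem_Icc, Prod.exists, planeMap_apply]
    constructor
    · rintro ⟨a, b, ⟨ha, h0, h1⟩, rfl⟩
      exact ⟨a, 2 * b, ⟨ha, by linarith, by linarith⟩, by module⟩
    · rintro ⟨a, b, ⟨ha, h0, h1⟩, rfl⟩
      exact ⟨a, 2⁻¹ * b, ⟨ha, by linarith, by linarith⟩, by module⟩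
  have s1 : planeMap u v ((2⁻¹, 2⁻¹) - (0, 2⁻¹)) = (2⁻¹ : ℝ) • u := by simp [planeMap_apply]
  have s2 : planeMap u v ((2⁻¹, 2⁻¹) - (1, 0)) = (2⁻¹ : ℝ) • (v - u) := by
    simp only [planeMap_apply, Prod.mk_sub_mk]
    module
  rw [coordClass_segment, s1, e4] at e1
  rw [coordClass_segment, s2, e5, e3] at e2
  rw [← eq_sub_iff_add_eq] at e1 e2
  rw [openParallelogramClass, e1, e2]
  abel

end DissectionClasses

/-! ### Generation of the dissection group by points, segments and areas. -/

section Triangulation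

open Set

/-- The extension is `f x⁺ - f x⁻`. Its additivity is `f` applied to the identity `(x + y)⁺ + x⁻ +
y⁻ = (x + y)⁻ + x⁺ + y⁺`, all of whose terms are nonnegative. -/
theorem exists_addMonoidHom_of_nonneg {A : Type*} [AddCommGroup A] (f : ℝ → A)
    (hf : ∀ x y, 0 ≤ x → 0 ≤ y → f (x + y) = f x + f y) :
    ∃ g : ℝ →+ A, ∀ x, 0 ≤ x → g x = f x := by
  have h0 : f 0 = 0 := by simpa using hf 0 0 le_rfl le_rfl
  refine ⟨AddMonoidHom.mk' (fun x => f (max x 0) - f (max (-x) 0)) fun x y => ?_, fun x hx => ?_⟩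
  · have hx : max x 0 = x + max (-x) 0 := by
      rcases le_total 0 x with h | h <;> simp [h]
    have hy : max y 0 = y + max (-y) 0 := by
      rcases le_total 0 y with h | h <;> simp [h]
    have hxy : max (x + y) 0 = x + y + max (-(x + y)) 0 := by
      rcases le_total 0 (x + y) with h | h
      · rw [max_eq_left h, max_eq_right (by linarith)]; ring
      · rw [max_eq_right h, max_eq_left (by linarith)]; ring
    have e : max (x + y) 0 + (max (-x) 0 + max (-y) 0)
        = max (-(x + y)) 0 + (max x 0 + max y 0) := by
      rw [hx, hy, hxy]; ring
    have hm : ∀ z : ℝ, 0 ≤ max z 0 := fun z => le_max_right _ _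
    have e' := congrArg f e
    rw [hf _ _ (hm _) (add_nonneg (hm _) (hm _)), hf _ _ (hm _) (hm _),
      hf _ _ (hm _) (add_nonneg (hm _) (hm _)), hf _ _ (hm _) (hm _)] at e'
    rw [eq_sub_of_add_eq e']
    abel
  · simp [hx, h0]

theorem Convex.mem_of_mem_segment_of_slice {E : Type*} [AddCommGroup E] [Module ℝ E] {P : Set E}
    (hP : Convex ℝ P) (f : E →ₗ[ℝ] ℝ) {k : ℝ} {x y z : E} (hyP : y ∈ P) (hy : k ≤ f y)
    (hz : f z ≤ k) (hx : k ≤ f x) (hxs : x ∈ segment ℝ y z)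
    (hslice : ∀ w ∈ segment ℝ y z, f w = k → w ∈ P) : x ∈ P := by
  rcases hz.lt_or_eq with hz | hz
  · exact hP.segment_subset hyP (hslice _ (crossPoint_mem_segment f hy hz) (map_crossPoint f hy hz))
      (mem_segment_crossPoint f hy hz hx hxs)
  · exact hP.segment_subset hyP (hslice z (right_mem_segment ℝ y z) hz) hxs

variable {V : Type*} [NormedAddCommGroup V] [InnerProductSpace ℝ V]

/-- Krein–Milman; finiteness of the set of extreme points makes the closure superfluous. -/
theorem convexHull_extremePoints_of_finite {s : Set V} (hs : s.Finite) :
    convexHull ℝ ((convexHull ℝ s).extremePoints ℝ) = convexHull ℝ s := by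
  have hfin : ((convexHull ℝ s).extremePoints ℝ).Finite := hs.subset extremePoints_convexHull_subset
  rw [← (hfin.isClosed_convexHull ℝ).closure_eq]
  exact closure_convexHull_extremePoints (hs.isCompact_convexHull ℝ) (convex_convexHull ℝ s)

/-- If `x` were on the line through `a` and `b` but outside the segment, one of these extreme points
would lie strictly between two points of `K`. -/
theorem mem_segment_of_extreme {K : Set V} {a b x : V}
    (ha : a ∈ K.extremePoints ℝ) (hb : b ∈ K.extremePoints ℝ) (hx : x ∈ K)
    (h : ∃ r : ℝ, x - a = r • (b - a)) : x ∈ segment ℝ a b := by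
  obtain ⟨r, hr⟩ := h
  have hcol : Collinear ℝ ({a, x, b} : Set V) := by
    rw [collinear_iff_of_mem (p₀ := a) (by simp)]
    refine ⟨b - a, ?_⟩
    rintro p (rfl | rfl | rfl)
    · exact ⟨0, by simp⟩
    · exact ⟨r, by rw [← hr]; simp⟩
    · exact ⟨1, by simp⟩
  rw [mem_extremePoints_iff_forall_segment] at ha hb
  rcases hcol.wbtw_or_wbtw_or_wbtw with h | h | h
  · exact mem_segment_iff_wbtw.2 h
  · rcases hb.2 x hx a ha.1 (mem_segment_iff_wbtw.2 h) with rfl | rfl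
    · exact right_mem_segment ℝ _ _
    · have : x - a = 0 := by simpa using hr
      rw [sub_eq_zero.1 this]
      exact left_mem_segment ℝ _ _
  · rcases ha.2 b hb.1 x hx (mem_segment_iff_wbtw.2 h) with rfl | rfl
    · have : x - b = 0 := by simpa using hr
      rw [sub_eq_zero.1 this]
      exact left_mem_segment ℝ _ _
    · exact left_mem_segment ℝ _ _

theorem linearIndependent_of_extreme {K : Set V} {a b c : V} (ha : a ∈ K.extremePoints ℝ)
    (hb : b ∈ K.extremePoints ℝ) (hc : c ∈ K.extremePoints ℝ) (hab : a ≠ b) (hac : a ≠ c)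
    (hbc : b ≠ c) : LinearIndependent ℝ ![b - a, c - a] := by
  rw [LinearIndependent.pair_iff' (sub_ne_zero.2 hab.symm)]
  intro r hr
  have hseg := mem_segment_of_extreme ha hb hc.1 ⟨r, hr.symm⟩
  rw [mem_extremePoints_iff_forall_segment] at hc
  rcases hc.2 a ha.1 b hb.1 hseg with h | h
  exacts [hac h, hbc h]

theorem exists_coord_of_linearIndependent (hV : Module.finrank ℝ V = 2) {u v : V}
    (h : LinearIndependent ℝ ![u, v]) :
    ∃ f : V →ₗ[ℝ] ℝ, f u = 0 ∧ f v = 1 ∧ ∀ w, f w = 0 → ∃ r : ℝ, w = r • u := by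
  let B := basisOfLinearIndependentOfCardEqFinrank h (by simp [hV])
  have h0 : B 0 = u := by simp [B]
  have h1 : B 1 = v := by simp [B]
  refine ⟨B.coord 1, ?_, ?_, fun w hw => ⟨B.coord 0 w, ?_⟩⟩
  · rw [← h0]; simp
  · rw [← h1]; simp
  · have := B.sum_repr w
    rw [Fin.sum_univ_two, h0, h1] at this
    have hw' : B.repr w 1 = 0 := hw
    rw [hw', zero_smul, add_zero] at this
    exact this.symm

theorem OrthonormalBasis.linearIndependent_pair (b : OrthonormalBasis (Fin 2) ℝ V) :
    LinearIndependent ℝ ![b 0, b 1] := by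
  have e : ![b 0, b 1] = b.toBasis := by
    ext i
    fin_cases i <;> simp
  rw [e]
  exact b.toBasis.linearIndependent

variable [FiniteDimensional ℝ V]

/-- Four vertices in a plane are affinely dependent, and Radon's theorem pairs them into two
crossing diagonals `ab` and `cd`. The line `ab` has `c` and `d` strictly on opposite sides and meets
the polygon exactly in the segment `ab`. Cutting there leaves two polygons, each missing a vertex,
that overlap in a segment. -/
theorem setClass_convexHull_mem_of_four_le_ncard {s : Set V} (hs : s.Finite)
    (hV : Module.finrank ℝ V = 2) (H : AddSubgroup (DissectionGroup V))
    (hseg : ∀ u : V, segmentClass u ∈ H)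
    (hext : (convexHull ℝ s).extremePoints ℝ = s) (h4 : 4 ≤ s.ncard)
    (ih : ∀ t : Set V, t.Finite → t.ncard < s.ncard → setClass (convexHull ℝ t) ∈ H) :
    setClass (convexHull ℝ s) ∈ H := by
  obtain ⟨t, hts, ht4⟩ : ∃ t : Finset V, (t : Set V) ⊆ s ∧ t.card = 4 := by
    obtain ⟨t, ht, htc⟩ := Finset.exists_subset_card_eq
      (show 4 ≤ hs.toFinset.card by rwa [← ncard_eq_toFinset_card s hs])
    exact ⟨t, fun x hx => hs.mem_toFinset.1 (ht hx), htc⟩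
  have hnai : ¬ AffineIndependent ℝ (Subtype.val : t → V) := fun h => by
    have h1 := h.card_le_finrank_succ
    have h2 := Submodule.finrank_le (vectorSpan ℝ (range (Subtype.val : t → V)))
    rw [hV] at h2
    rw [Fintype.card_coe, ht4] at h1
    omega
  obtain ⟨I, p, hpA, hpB⟩ := Convex.radon_partition hnai
  set A := Subtype.val '' I with hA
  set B := Subtype.val '' Iᶜ with hB
  have hdisj : Disjoint A B := by
    rw [hA, hB, disjoint_image_iff Subtype.val_injective]
    exact disjoint_compl_right
  have hunion : A ∪ B = t := by
    rw [hA, hB, ← image_union, union_compl_self, image_univ]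
    simp
  have hAs : A ⊆ s := (hunion ▸ subset_union_left : A ⊆ t).trans hts
  have hBs : B ⊆ s := (hunion ▸ subset_union_right : B ⊆ t).trans hts
  have hcard : A.ncard + B.ncard = 4 := by
    rw [← ncard_union_eq hdisj (hs.subset hAs) (hs.subset hBs), hunion, ncard_coe_finset, ht4]
  -- A Radon part with a single point would put a vertex in the hull of other vertices, so the
  -- partition is two against two.
  have htwo : ∀ A B : Set V, A ⊆ s → B ⊆ s → Disjoint A B → p ∈ convexHull ℝ A →
      p ∈ convexHull ℝ B → 2 ≤ A.ncard := by
    intro A B hA hB hdisj hpA hpB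
    by_contra! hlt
    have hAne : A.Nonempty := convexHull_nonempty_iff.1 ⟨p, hpA⟩
    have h1 : A.ncard = 1 := by
      have := (ncard_pos (hs.subset hA)).2 hAne
      omega
    obtain ⟨x, rfl⟩ := ncard_eq_one.1 h1
    rw [convexHull_singleton, mem_singleton_iff] at hpA
    subst hpA
    have hx : p ∈ (convexHull ℝ s).extremePoints ℝ := by
      rw [hext]
      exact hA rfl
    have := inter_extremePoints_subset_extremePoints_of_subset (convexHull_mono hB) ⟨hpB, hx⟩
    exact disjoint_left.1 hdisj rfl (extremePoints_convexHull_subset this)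
  have hA2 := htwo A B hAs hBs hdisj hpA hpB
  have hB2 := htwo B A hBs hAs hdisj.symm hpB hpA
  obtain ⟨a, b, hab, hAe⟩ := ncard_eq_two.1 (show A.ncard = 2 by omega)
  obtain ⟨c, d, hcd, hBe⟩ := ncard_eq_two.1 (show B.ncard = 2 by omega)
  clear_value A B
  subst hAe hBe
  have ha : a ∈ s := hAs (by simp)
  have hb : b ∈ s := hAs (by simp)
  have hc : c ∈ s := hBs (by simp)
  have hd : d ∈ s := hBs (by simp)
  have hac : a ≠ c := fun h => disjoint_left.1 hdisj (show a ∈ {a, b} by simp) (by simp [h])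
  have hbc : b ≠ c := fun h => disjoint_left.1 hdisj (show b ∈ {a, b} by simp) (by simp [h])
  have hE : ∀ {x}, x ∈ s → x ∈ (convexHull ℝ s).extremePoints ℝ := fun hx => hext.symm ▸ hx
  obtain ⟨f, hf0, hf1, hker⟩ := exists_coord_of_linearIndependent hV
    (linearIndependent_of_extreme (hE ha) (hE hb) (hE hc) hab hac hbc)
  rw [map_sub, sub_eq_zero] at hf0
  rw [map_sub] at hf1
  have hslice : ∀ x ∈ convexHull ℝ s, f x = f a → x ∈ segment ℝ a b := fun x hx hfx =>
    mem_segment_of_extreme (hE ha) (hE hb) hx (hker _ (by rw [map_sub, hfx, sub_self]))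
  -- The crossing point `p` has level `f a`, while `c` lies strictly above it. If `d` were not
  -- strictly below, `c` would have weight zero in `p`, so `d = p` would lie on the segment `ab`,
  -- contradicting extremality.
  have hfd : f d < f a := by
    rw [convexHull_pair] at hpA hpB
    have hpk : f p = f a := by
      obtain ⟨α, β, -, -, h, rfl⟩ := hpA
      simp only [map_add, map_smul, smul_eq_mul, hf0]
      rw [← add_mul, h, one_mul]
    by_contra! hge
    obtain ⟨α, β, hα, hβ, h, hp⟩ := hpB
    have h1 : α * (f c - f a) + β * (f d - f a) = 0 := by
      have := congrArg f hp
      simp only [map_add, map_smul, smul_eq_mul, hpk] at this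
      linear_combination this - h * f a
    have hα0 : α = 0 := by
      have := mul_nonneg hβ (sub_nonneg.2 hge)
      rw [hf1] at h1
      linarith
    have hpd : d = p := by
      rw [← hp, hα0, show β = 1 by linarith]
      simp
    have hdd := hE hd
    rw [mem_extremePoints_iff_forall_segment] at hdd
    rcases hdd.2 a (hE ha).1 b (hE hb).1 (hpd ▸ hpA) with h | h
    · exact disjoint_left.1 hdisj (show a ∈ {a, b} by simp) (by simp [h])
    · exact disjoint_left.1 hdisj (show b ∈ {a, b} by simp) (by simp [h])
  set P := {x ∈ s | f a ≤ f x} with hP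
  set N := {x ∈ s | f x ≤ f a} with hN
  have hPs : P ⊆ s := sep_subset _ _
  have hNs : N ⊆ s := sep_subset _ _
  have haP : a ∈ P := ⟨ha, le_rfl⟩
  have haN : a ∈ N := ⟨ha, le_rfl⟩
  have hbP : b ∈ P := ⟨hb, hf0.ge⟩
  have hbN : b ∈ N := ⟨hb, hf0.le⟩
  have hPN : P ∪ N = s := by
    refine subset_antisymm (union_subset hPs hNs) fun x hx => ?_
    rcases le_total (f a) (f x) with h | h
    exacts [Or.inl ⟨hx, h⟩, Or.inr ⟨hx, h⟩]
  have hPlt : P.ncard < s.ncard :=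
    ncard_lt_ncard ⟨hPs, fun h => absurd (h hd).2 (not_le.2 hfd)⟩ hs
  have hNlt : N.ncard < s.ncard :=
    ncard_lt_ncard ⟨hNs, fun h => absurd (h hc).2 (by linarith)⟩ hs
  have hPf : convexHull ℝ P ⊆ {x | f a ≤ f x} :=
    convexHull_min (fun x hx => hx.2) (convex_halfSpace_ge f.isLinear _)
  have hNf : convexHull ℝ N ⊆ {x | f x ≤ f a} :=
    convexHull_min (fun x hx => hx.2) (convex_halfSpace_le f.isLinear _)
  have hsegP : segment ℝ a b ⊆ convexHull ℝ P :=
    segment_subset_convexHull haP hbP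
  have hsegN : segment ℝ a b ⊆ convexHull ℝ N :=
    segment_subset_convexHull haN hbN
  have hun : convexHull ℝ P ∪ convexHull ℝ N = convexHull ℝ s := by
    refine subset_antisymm (union_subset (convexHull_mono hPs) (convexHull_mono hNs)) fun x hx => ?_
    have hx' := hx
    rw [← hPN, convexHull_union ⟨a, haP⟩ ⟨a, haN⟩, mem_convexJoin] at hx'
    obtain ⟨y, hy, z, hz, hxyz⟩ := hx'
    have hyzs : segment ℝ y z ⊆ convexHull ℝ s := (convex_convexHull ℝ s).segment_subset
      (convexHull_mono hPs hy) (convexHull_mono hNs hz)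
    rcases le_total (f a) (f x) with h | h
    · exact Or.inl ((convex_convexHull ℝ P).mem_of_mem_segment_of_slice f hy (hPf hy) (hNf hz) h
        hxyz fun w hw hfw => hsegP (hslice w (hyzs hw) hfw))
    · refine Or.inr ((convex_convexHull ℝ N).mem_of_mem_segment_of_slice (-f) (k := -f a) hz
        (neg_le_neg (hNf hz)) (neg_le_neg (hPf hy)) (neg_le_neg h)
        (segment_symm ℝ y z ▸ hxyz) fun w hw hfw => hsegN (hslice w (hyzs ?_) (neg_inj.1 hfw)))
      rwa [segment_symm]
  have hin : convexHull ℝ P ∩ convexHull ℝ N = segment ℝ a b := by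
    refine subset_antisymm (fun x hx => ?_) (subset_inter hsegP hsegN)
    exact hslice x (convexHull_mono hPs hx.1) (le_antisymm (hNf hx.2) (hPf hx.1))
  have hPfin := hs.subset hPs
  have hNfin := hs.subset hNs
  have hfinal := setClass_union_add_inter ⟨P, hPfin, rfl⟩ ⟨N, hNfin, rfl⟩
    (hun ▸ ⟨s, hs, rfl⟩)
  rw [hun, hin, setClass_segment, ← eq_sub_iff_add_eq] at hfinal
  rw [hfinal]
  exact H.sub_mem (H.add_mem (ih P hPfin hPlt) (ih N hNfin hNlt)) (hseg _)

/-- Strong induction on the number of spanning points. Points that are not extreme can be discarded,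
and when all are extreme, at most three of them span a generator. -/
theorem setClass_convexHull_mem (hV : Module.finrank ℝ V = 2) (H : AddSubgroup (DissectionGroup V))
    (hpt : pointClass V ∈ H) (hseg : ∀ u : V, segmentClass u ∈ H)
    (htri : ∀ u v : V, LinearIndependent ℝ ![u, v] → triangleClass u v ∈ H) {s : Set V}
    (hs : s.Finite) : setClass (convexHull ℝ s) ∈ H := by
  induction hn : s.ncard using Nat.strong_induction_on generalizing s with
  | _ n ih =>
  subst hn
  by_cases hext : (convexHull ℝ s).extremePoints ℝ = s
  · by_cases h4 : 4 ≤ s.ncard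
    · exact setClass_convexHull_mem_of_four_le_ncard hs hV H hseg hext h4
        fun t ht hlt => ih _ hlt ht rfl
    · have hE : ∀ {x}, x ∈ s → x ∈ (convexHull ℝ s).extremePoints ℝ := fun hx => hext.symm ▸ hx
      obtain h | h | h | h : s.ncard = 0 ∨ s.ncard = 1 ∨ s.ncard = 2 ∨ s.ncard = 3 := by omega
      · rw [(ncard_eq_zero hs).1 h, convexHull_empty, setClass_empty]
        exact H.zero_mem
      · obtain ⟨a, rfl⟩ := ncard_eq_one.1 h
        rw [convexHull_singleton, setClass_singleton]
        exact hpt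
      · obtain ⟨a, b, -, rfl⟩ := ncard_eq_two.1 h
        rw [convexHull_pair, setClass_segment]
        exact hseg _
      · obtain ⟨a, b, c, hab, hac, hbc, rfl⟩ := ncard_eq_three.1 h
        have hli := linearIndependent_of_extreme (hE (x := a) (by simp)) (hE (x := b) (by simp))
          (hE (x := c) (by simp)) hab hac hbc
        have himg : (fun x => a + x) '' convexHull ℝ {0, b - a, c - a}
            = convexHull ℝ {a, b, c} := by
          have := (AffineEquiv.constVAdd ℝ V a).toAffineMap.image_convexHull {0, b - a, c - a}
          refine this.trans ?_
          simp [image_insert_eq]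
        rw [← himg, setClass_add_left a ⟨_, by simp, rfl⟩]
        exact htri _ _ hli
  · have hsub : (convexHull ℝ s).extremePoints ℝ ⊆ s := extremePoints_convexHull_subset
    have := ih _ (ncard_lt_ncard (hsub.ssubset_of_ne hext) hs) (hs.subset hsub) rfl
    rwa [convexHull_extremePoints_of_finite hs] at this

theorem eq_top_of_triangleClass_mem (hV : Module.finrank ℝ V = 2)
    (H : AddSubgroup (DissectionGroup V))
    (hpt : pointClass V ∈ H) (hseg : ∀ u : V, segmentClass u ∈ H)
    (htri : ∀ u v : V, LinearIndependent ℝ ![u, v] → triangleClass u v ∈ H) : H = ⊤ := by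
  have hclass : ∀ C : Polytope V, polytopeClass C ∈ H := fun C => by
    obtain ⟨s, hs, hC⟩ := C.2
    rw [← setClass_val, hC]
    exact setClass_convexHull_mem hV H hpt hseg htri hs
  rw [eq_top_iff]
  intro k _
  obtain ⟨a, rfl⟩ := QuotientAddGroup.mk_surjective k
  induction a using FreeAbelianGroup.induction_on with
  | zero => exact H.zero_mem
  | of C => exact hclass C
  | neg C h => exact H.neg_mem (h trivial)
  | add a b ha hb => exact H.add_mem (ha trivial) (hb trivial)

/-- A reflection turns `u` into `‖u‖ • b 0`, a shear makes the second side a multiple `β • b 1`, and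
the factor `β` is then moved to the first side. -/
theorem openParallelogramClass_eq_smul (b : OrthonormalBasis (Fin 2) ℝ V) {u v : V}
    (h : LinearIndependent ℝ ![u, v]) :
    ∃ a : ℝ, 0 ≤ a ∧ openParallelogramClass u v = openParallelogramClass (a • b 0) (b 1) := by
  have hu : ‖u‖ ≠ 0 := norm_ne_zero_iff.2 (h.ne_zero 0)
  let g : V ≃ₗᵢ[ℝ] V := Submodule.reflection (Submodule.span ℝ {u - ‖u‖ • b 0})ᗮ
  have hgu : g u = ‖u‖ • b 0 := Submodule.reflection_sub (by simp [norm_smul])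
  obtain ⟨α, β, hgv⟩ : ∃ α β : ℝ, g v = α • b 0 + β • b 1 := by
    have := b.sum_repr (g v)
    rw [Fin.sum_univ_two] at this
    exact ⟨_, _, this.symm⟩
  have hgli : LinearIndependent ℝ ![‖u‖ • b 0, α • b 0 + β • b 1] := by
    rw [← hgu, ← hgv]
    rw [LinearIndependent.pair_iff] at h ⊢
    intro s t hst
    refine h s t (g.injective ?_)
    rw [map_zero, ← hst, map_add, map_smul, map_smul]
  have hβ : β ≠ 0 := by
    rintro rfl
    have := (LinearIndependent.pair_iff.1 hgli) (-α) ‖u‖ (by module)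
    exact hu this.2
  have hb01 := b.linearIndependent_pair
  have hli : LinearIndependent ℝ ![‖u‖ • b 0, β • b 1] := by
    rw [LinearIndependent.pair_iff] at hb01 ⊢
    intro s t hst
    have := hb01 (s * ‖u‖) (t * β) (by rw [← hst]; module)
    simpa [hu, hβ] using this
  -- This is `|β| * ‖u‖`, the area of the parallelogram.
  refine ⟨β * ‖u‖ * SignType.sign β, by
    rw [mul_right_comm, mul_comm β, sign_mul_self]; positivity, ?_⟩
  rw [← openParallelogramClass_map g, hgu, hgv]
  have e1 : α • b 0 + β • b 1 = β • b 1 + (α / ‖u‖) • (‖u‖ • b 0) := by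
    rw [smul_smul, div_mul_cancel₀ _ hu, add_comm]
  rw [e1, openParallelogramClass_add_smul hli, ← openParallelogramClass_inv_smul hli hβ, smul_smul,
    smul_smul, inv_mul_cancel₀ hβ, one_smul]
  rcases lt_or_gt_of_ne hβ with hneg | hpos
  · rw [sign_neg hneg]
    simp only [SignType.coe_neg_one, mul_neg, mul_one, neg_smul]
    rw [openParallelogramClass_neg_left]
  · rw [sign_pos hpos]
    simp

theorem exists_dissectionGroup_generators (hV : Module.finrank ℝ V = 2)
    (b : OrthonormalBasis (Fin 2) ℝ V) :
    ∃ σ q : ℝ →+ DissectionGroup V,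
      (∀ x, 0 ≤ x → segmentClass (x • b 0) = σ x + pointClass V) ∧
      (∀ x, 0 ≤ x → openParallelogramClass (x • b 0) (b 1) = q x) ∧
      (∀ k, ∃ (n : ℤ) (x y : ℝ), k = n • pointClass V + σ x + q y) := by
  have hb01 := b.linearIndependent_pair
  have hb0 : b 0 ≠ 0 := hb01.ne_zero 0
  obtain ⟨σ, hσ⟩ := exists_addMonoidHom_of_nonneg
    (fun x => segmentClass (x • b 0) - pointClass V) fun x y hx hy => by
      rw [eq_sub_iff_add_eq.2 (segmentClass_add_smul hb0 hx hy)]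
      abel
  obtain ⟨q, hq⟩ := exists_addMonoidHom_of_nonneg
    (fun x => openParallelogramClass (x • b 0) (b 1)) fun x y hx hy =>
      openParallelogramClass_add_smul_left hb01 hx hy
  refine ⟨σ, q, fun x hx => by rw [hσ x hx]; abel, fun x hx => (hq x hx).symm, ?_⟩
  let G : ℤ × ℝ × ℝ →+ DissectionGroup V :=
    (zmultiplesHom _ (pointClass V)).coprod (σ.coprod q)
  have hpt : pointClass V ∈ G.range := ⟨(1, 0, 0), by simp [G]⟩
  have hseg : ∀ u : V, segmentClass u ∈ G.range := fun u => by
    rw [segmentClass_of_norm_eq (v := ‖u‖ • b 0) (by simp [norm_smul])]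
    refine ⟨(1, ‖u‖, 0), ?_⟩
    simp [G, hσ _ (norm_nonneg u)]
  have hpar : ∀ u v : V, LinearIndependent ℝ ![u, v] →
      openParallelogramClass u v ∈ G.range := fun u v h => by
    obtain ⟨a, ha, he⟩ := openParallelogramClass_eq_smul b h
    exact ⟨(0, 0, a), by simp [G, he, hq a ha]⟩
  have htop := eq_top_of_triangleClass_mem hV G.range hpt hseg fun u v h => by
    have h2 : LinearIndependent ℝ ![u, (2⁻¹ : ℝ) • v] := by
      rw [LinearIndependent.pair_iff] at h ⊢
      intro s t hst
      have := h s (t * 2⁻¹) (by rw [← hst]; module)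
      simpa using this
    rw [triangleClass_eq h]
    exact G.range.sub_mem (G.range.add_mem (G.range.sub_mem (G.range.add_mem
      (G.range.add_mem (hpar _ _ h2) (hseg _)) (hseg _)) hpt) (hseg _)) (hseg _)
  intro k
  obtain ⟨⟨n, x, y⟩, rfl⟩ := AddMonoidHom.range_eq_top.1 htop k
  exact ⟨n, x, y, by simp [G, add_assoc]⟩

end Triangulation

/-! ### Parallel volumes of the generators and the Steiner formula. -/

section SteinerFormula

open Set

/-- Replacing `y` by `(m + 1)² • y` multiplies `e y` by `(m + 1)²` but the bound by at most `m + 1`.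
-/
theorem AddMonoidHom.eq_zero_of_abs_le_sqrt (e : ℝ →+ ℝ) {A B : ℝ} (hB : 0 ≤ B)
    (h : ∀ y, 0 ≤ y → |e y| ≤ A * √y + B) : e = 0 := by
  have hpos : ∀ y, 0 ≤ y → e y = 0 := by
    intro y hy
    by_contra hne
    have hpos : 0 < |e y| := abs_pos.2 hne
    obtain ⟨m, hm⟩ := exists_nat_gt ((A * √y + B) / |e y|)
    rw [div_lt_iff₀ hpos] at hm
    have hmul : e (((m + 1) ^ 2 : ℕ) • y) = ((m + 1) ^ 2 : ℕ) • e y := map_nsmul e _ _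
    have hb := h (((m + 1) ^ 2 : ℕ) • y) (by positivity)
    rw [hmul] at hb
    simp only [nsmul_eq_mul, Nat.cast_pow, Nat.cast_add, Nat.cast_one] at hb
    rw [abs_mul, abs_of_nonneg (by positivity), Real.sqrt_mul (by positivity),
      Real.sqrt_sq (by positivity)] at hb
    have hm0 : (0 : ℝ) ≤ m := m.cast_nonneg
    nlinarith
  ext y
  rcases le_total 0 y with hy | hy
  · exact hpos y hy
  · have := hpos (-y) (by linarith)
    simpa using this

variable {V : Type*} [NormedAddCommGroup V] [InnerProductSpace ℝ V]

theorem abs_repr_le_norm (b : OrthonormalBasis (Fin 2) ℝ V) (x : V) (i : Fin 2) :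
    |b.repr x i| ≤ ‖x‖ := by
  rw [← b.repr.norm_map x]
  exact PiLp.norm_apply_le (b.repr x) i

theorem repr_smul_zero_add_smul_one (b : OrthonormalBasis (Fin 2) ℝ V) (s t : ℝ) :
    b.repr (s • b 0 + t • b 1) 0 = s ∧ b.repr (s • b 0 + t • b 1) 1 = t := by
  simp

theorem eq_smul_zero_add_smul_one (b : OrthonormalBasis (Fin 2) ℝ V) (x : V) :
    x = b.repr x 0 • b 0 + b.repr x 1 • b 1 := by
  have := b.sum_repr x
  rw [Fin.sum_univ_two] at this
  exact this.symm

variable [FiniteDimensional ℝ V] [MeasurableSpace V] [BorelSpace V]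

theorem volume_rectangle (b : OrthonormalBasis (Fin 2) ℝ V) (a₀ c₀ a₁ c₁ : ℝ) :
    volume {x : V | b.repr x 0 ∈ Icc a₀ c₀ ∧ b.repr x 1 ∈ Icc a₁ c₁}
      = ENNReal.ofReal (c₀ - a₀) * ENNReal.ofReal (c₁ - a₁) := by
  have hmp := (PiLp.volume_preserving_ofLp (Fin 2)).comp b.measurePreserving_repr
  have hset : {x : V | b.repr x 0 ∈ Icc a₀ c₀ ∧ b.repr x 1 ∈ Icc a₁ c₁} =
      (WithLp.ofLp ∘ b.repr) ⁻¹' (univ.pi ![Icc a₀ c₀, Icc a₁ c₁]) := by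
    ext x
    simp [Fin.forall_fin_two]
  have hms : MeasurableSet (univ.pi ![Icc a₀ c₀, Icc a₁ c₁]) :=
    MeasurableSet.univ_pi fun i => by fin_cases i <;> exact measurableSet_Icc
  rw [hset, hmp.measure_preimage hms.nullMeasurableSet, volume_pi_pi]
  simp

theorem volume_real_rectangle (b : OrthonormalBasis (Fin 2) ℝ V) {a₀ c₀ a₁ c₁ : ℝ}
    (h₀ : a₀ ≤ c₀) (h₁ : a₁ ≤ c₁) :
    volume.real {x : V | b.repr x 0 ∈ Icc a₀ c₀ ∧ b.repr x 1 ∈ Icc a₁ c₁}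
      = (c₀ - a₀) * (c₁ - a₁) := by
  rw [measureReal_def, volume_rectangle]
  simp [h₀, h₁]

theorem volume_rectangle_ne_top (b : OrthonormalBasis (Fin 2) ℝ V) (a₀ c₀ a₁ c₁ : ℝ) :
    volume {x : V | b.repr x 0 ∈ Icc a₀ c₀ ∧ b.repr x 1 ∈ Icc a₁ c₁} ≠ ⊤ := by
  rw [volume_rectangle]
  exact ENNReal.mul_ne_top ENNReal.ofReal_ne_top ENNReal.ofReal_ne_top

theorem volume_real_closedBall_of_finrank_eq_two (hV : Module.finrank ℝ V = 2) {ρ : ℝ}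
    (hρ : 0 ≤ ρ) : volume.real (Metric.closedBall (0 : V) ρ) = Real.pi * ρ ^ 2 := by
  have : Nontrivial V := Module.nontrivial_of_finrank_pos (R := ℝ) (by omega)
  rw [measureReal_def, InnerProductSpace.volume_closedBall_of_dim_even (k := 1) (by simpa using hV),
    hV]
  simp [hρ, mul_comm, Real.pi_pos.le]

theorem IsFiniteHull.volume_parallelBody_ne_top {C : Set V} (hC : IsFiniteHull C) (ρ : ℝ) :
    volume (C + Metric.closedBall (0 : V) ρ) ≠ ⊤ :=
  ((IsPolytope.isCompact hC).add (isCompact_closedBall 0 ρ)).measure_lt_top.ne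

/-- The parallel body lies between two rectangles. The rounded caps need not be measured: any
bounded error disappears by additivity. -/
theorem parallelVolume_segment_bounds (b : OrthonormalBasis (Fin 2) ℝ V) {ρ l : ℝ} (hρ : 0 ≤ ρ)
    (hl : 0 ≤ l) : 2 * ρ * l ≤ parallelVolume ρ (segment ℝ 0 (l • b 0)) ∧
      parallelVolume ρ (segment ℝ 0 (l • b 0)) ≤ 2 * ρ * (l + 2 * ρ) := by
  have hmem : ∀ x : V, x ∈ segment ℝ 0 (l • b 0) ↔ ∃ t, 0 ≤ t ∧ t ≤ l ∧ x = t • b 0 := by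
    intro x
    have : segment ℝ 0 (l • b 0) = (fun t : ℝ => t • b 0) '' Icc 0 l := by
      rw [← segment_eq_Icc hl]
      have := image_segment ℝ (LinearMap.toSpanSingleton ℝ V (b 0)).toAffineMap 0 l
      simpa using this.symm
    rw [this]
    simp only [mem_image, mem_Icc, and_assoc, eq_comm]
  constructor
  · have h := volume_real_rectangle b hl (show -ρ ≤ ρ by linarith)
    rw [show 2 * ρ * l = (l - 0) * (ρ - -ρ) by ring, ← h]
    refine measureReal_mono ?_ ((isFiniteHull_segment _ _).volume_parallelBody_ne_top ρ)
    rintro x ⟨⟨h1, h2⟩, h3⟩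
    refine ⟨b.repr x 0 • b 0, (hmem _).2 ⟨_, h1, h2, rfl⟩, b.repr x 1 • b 1, ?_,
      (eq_smul_zero_add_smul_one b x).symm⟩
    simpa [norm_smul, abs_le] using h3
  · have h := volume_real_rectangle b (show -ρ ≤ l + ρ by linarith) (show -ρ ≤ ρ by linarith)
    rw [show 2 * ρ * (l + 2 * ρ) = (l + ρ - -ρ) * (ρ - -ρ) by ring, ← h]
    refine measureReal_mono ?_ (volume_rectangle_ne_top b _ _ _ _)
    rintro _ ⟨y, hy, z, hz, rfl⟩
    obtain ⟨t, h0, h1, rfl⟩ := (hmem y).1 hy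
    have hz' : ‖z‖ ≤ ρ := by simpa using hz
    have e0 := abs_le.1 ((abs_repr_le_norm b z 0).trans hz')
    have e1 := abs_le.1 ((abs_repr_le_norm b z 1).trans hz')
    have r0 := (repr_smul_zero_add_smul_one b t 0).1
    have r1 := (repr_smul_zero_add_smul_one b t 0).2
    rw [zero_smul, add_zero] at r0 r1
    change b.repr (t • b 0 + z) 0 ∈ _ ∧ b.repr (t • b 0 + z) 1 ∈ _
    rw [map_add, PiLp.add_apply, PiLp.add_apply, r0, r1]
    refine ⟨⟨?_, ?_⟩, ?_, ?_⟩ <;> linarith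

theorem parallelVolume_square_bounds (b : OrthonormalBasis (Fin 2) ℝ V) {ρ l : ℝ} (hρ : 0 ≤ ρ)
    (hl : 0 ≤ l) :
    l ^ 2 ≤ parallelVolume ρ (planeMap (l • b 0) (l • b 1) '' (Icc 0 1 ×ˢ Icc 0 1)) ∧
      parallelVolume ρ (planeMap (l • b 0) (l • b 1) '' (Icc 0 1 ×ˢ Icc 0 1))
        ≤ (l + 2 * ρ) ^ 2 := by
  have hmem : ∀ x : V, x ∈ planeMap (l • b 0) (l • b 1) '' (Icc 0 1 ×ˢ Icc 0 1) ↔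
      ∃ s t, (0 ≤ s ∧ s ≤ l) ∧ (0 ≤ t ∧ t ≤ l) ∧ x = s • b 0 + t • b 1 := by
    intro x
    simp only [mem_image, mem_prod, mem_Icc, Prod.exists, planeMap_apply]
    constructor
    · rintro ⟨s, t, ⟨⟨_, _⟩, _, _⟩, rfl⟩
      refine ⟨s * l, t * l, ⟨by positivity, by nlinarith⟩, ⟨by positivity, by nlinarith⟩,
        by module⟩
    · rintro ⟨s, t, ⟨hs0, hs1⟩, ⟨ht0, ht1⟩, rfl⟩
      rcases hl.eq_or_lt with rfl | hl
      · obtain rfl : s = 0 := le_antisymm hs1 hs0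
        obtain rfl : t = 0 := le_antisymm ht1 ht0
        exact ⟨0, 0, by simp, by simp⟩
      · refine ⟨s / l, t / l, ⟨⟨by positivity, (div_le_one hl).2 hs1⟩, by positivity,
          (div_le_one hl).2 ht1⟩, ?_⟩
        rw [smul_smul, smul_smul, div_mul_cancel₀ _ hl.ne', div_mul_cancel₀ _ hl.ne']
  have hhull : IsFiniteHull (planeMap (l • b 0) (l • b 1) '' (Icc 0 1 ×ˢ Icc 0 1)) :=
    (isFiniteHull_box zero_le_one zero_le_one).planeMap _ _
  constructor
  · have h := volume_real_rectangle b hl hl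
    rw [show l ^ 2 = (l - 0) * (l - 0) by ring, ← h]
    refine measureReal_mono ?_ (hhull.volume_parallelBody_ne_top ρ)
    rintro x ⟨h1, h2⟩
    exact ⟨x, (hmem x).2 ⟨_, _, h1, h2, eq_smul_zero_add_smul_one b x⟩, 0, by simpa using hρ,
      add_zero x⟩
  · have h := volume_real_rectangle b (show -ρ ≤ l + ρ by linarith) (show -ρ ≤ l + ρ by linarith)
    rw [show (l + 2 * ρ) ^ 2 = (l + ρ - -ρ) * (l + ρ - -ρ) by ring, ← h]
    refine measureReal_mono ?_ (volume_rectangle_ne_top b _ _ _ _)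
    rintro _ ⟨y, hy, z, hz, rfl⟩
    obtain ⟨s, t, hs, ht, rfl⟩ := (hmem y).1 hy
    have hz' : ‖z‖ ≤ ρ := by simpa using hz
    have e0 := abs_le.1 ((abs_repr_le_norm b z 0).trans hz')
    have e1 := abs_le.1 ((abs_repr_le_norm b z 1).trans hz')
    obtain ⟨r0, r1⟩ := repr_smul_zero_add_smul_one b s t
    change b.repr (s • b 0 + t • b 1 + z) 0 ∈ _ ∧ b.repr (s • b 0 + t • b 1 + z) 1 ∈ _
    rw [map_add, PiLp.add_apply, PiLp.add_apply, r0, r1]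
    refine ⟨⟨?_, ?_⟩, ?_, ?_⟩ <;> linarith

theorem dissectionParallelVolume_setClass (hV : Module.finrank ℝ V = 2) (ρ : ℝ) {C : Set V}
    (hC : IsFiniteHull C) : dissectionParallelVolume hV ρ (setClass C) = parallelVolume ρ C :=
  (congrArg _ (setClass_val ⟨C, hC⟩)).trans (dissectionParallelVolume_polytopeClass hV ρ ⟨C, hC⟩)

theorem dissectionParallelVolume_pointClass (hV : Module.finrank ℝ V = 2) {ρ : ℝ} (hρ : 0 ≤ ρ) :
    dissectionParallelVolume hV ρ (pointClass V) = Real.pi * ρ ^ 2 := by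
  rw [pointClass, dissectionParallelVolume_setClass hV ρ (isFiniteHull_singleton 0), parallelVolume,
    singleton_zero, zero_add, volume_real_closedBall_of_finrank_eq_two hV hρ]

/-- The dissection group of a Euclidean plane is `ℤ × ℝ²`, in such a way that the coordinates of
a class are the coefficients of its Steiner polynomial. -/
theorem exists_dissectionGroup_equiv (hV : Module.finrank ℝ V = 2) :
    ∃ Φ : DissectionGroup V ≃+ ℤ × ℝ × ℝ, ∀ ρ, 0 ≤ ρ → ∀ k, dissectionParallelVolume hV ρ k
      = (Φ k).2.2 + 2 * (Φ k).2.1 * ρ + Real.pi * (Φ k).1 * ρ ^ 2 := by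
  let b : OrthonormalBasis (Fin 2) ℝ V := (stdOrthonormalBasis ℝ V).reindex (finCongr hV)
  obtain ⟨σ, q, hσ, hq, hsurj⟩ := exists_dissectionGroup_generators hV b
  have hσF : ∀ ρ, 0 ≤ ρ → ∀ x, dissectionParallelVolume hV ρ (σ x) = 2 * x * ρ := by
    intro ρ hρ x
    have := ((dissectionParallelVolume hV ρ).comp σ
      - AddMonoidHom.mulLeft (2 * ρ)).eq_zero_of_abs_le_sqrt (A := 0)
      -- The rectangle bounds contribute the error `4ρ²`, and the point subtracted in `σ`
      -- contributes `πρ²`.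
      (B := 4 * ρ ^ 2 + Real.pi * ρ ^ 2) (by positivity) fun y hy => by
        obtain ⟨h1, h2⟩ := parallelVolume_segment_bounds b hρ hy
        rw [← dissectionParallelVolume_setClass hV ρ (isFiniteHull_segment _ _)] at h1 h2
        have h3 := congrArg (dissectionParallelVolume hV ρ) (hσ y hy)
        rw [segmentClass, map_add, dissectionParallelVolume_pointClass hV hρ] at h3
        rw [h3] at h1 h2
        have h4 : 0 ≤ Real.pi * ρ ^ 2 := by positivity
        simp only [AddMonoidHom.sub_apply, AddMonoidHom.comp_apply, AddMonoidHom.coe_mulLeft]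
        rw [abs_le]
        constructor <;> nlinarith
    have := DFunLike.congr_fun this x
    simp only [AddMonoidHom.sub_apply, AddMonoidHom.comp_apply, AddMonoidHom.coe_mulLeft,
      AddMonoidHom.zero_apply] at this
    linarith
  have hqF : ∀ ρ, 0 ≤ ρ → ∀ y, dissectionParallelVolume hV ρ (q y) = y := by
    intro ρ hρ y
    have := ((dissectionParallelVolume hV ρ).comp q
      - AddMonoidHom.id ℝ).eq_zero_of_abs_le_sqrt (A := 4 * ρ)
      (B := 4 * ρ ^ 2 + Real.pi * ρ ^ 2) (by positivity) fun y hy => by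
        rcases hy.eq_or_lt with rfl | hy0
        · simp; positivity
        have hl := Real.sqrt_pos.2 hy0
        have hly := Real.sq_sqrt hy
        obtain ⟨h1, h2⟩ := parallelVolume_square_bounds b hρ hl.le
        rw [hly] at h1
        set l := √y with hl'
        -- The `y × 1` rectangle is replaced by the square of side `√y`. Its perimeter, and with it
        -- the error in the parallel volume, grows only like `√y`; for the rectangle it would be
        -- linear in `y`.
        have hpar : q y = openParallelogramClass (l • b 0) (l • b 1) := by
          rw [← hq y hy]
          have hli : LinearIndependent ℝ ![l • b 0, l • b 1] := by
            have hb := b.linearIndependent_pair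
            rw [LinearIndependent.pair_iff] at hb ⊢
            intro s t hst
            have := hb (s * l) (t * l) (by rw [← hst]; module)
            simpa [hl.ne'] using this
          rw [← openParallelogramClass_inv_smul hli hl.ne', smul_smul, smul_smul,
            inv_mul_cancel₀ hl.ne', one_smul, ← pow_two, hly]
        have hseg : segmentClass (l • b 1) = segmentClass (l • b 0) :=
          segmentClass_of_norm_eq (by simp [norm_smul])
        rw [← dissectionParallelVolume_setClass hV ρ
          ((isFiniteHull_box zero_le_one zero_le_one).planeMap _ _)] at h1 h2
        have h3 := congrArg (dissectionParallelVolume hV ρ) hpar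
        rw [openParallelogramClass, hseg, hσ l hl.le, map_add, map_sub, map_sub, map_add, hσF ρ hρ,
          dissectionParallelVolume_pointClass hV hρ, parallelogramClass, coordClass] at h3
        have h4 : 0 ≤ Real.pi * ρ ^ 2 := by positivity
        have h5 : 0 ≤ ρ * l := by positivity
        simp only [AddMonoidHom.sub_apply, AddMonoidHom.comp_apply, AddMonoidHom.id_apply]
        rw [abs_le]
        constructor <;> nlinarith
    have := DFunLike.congr_fun this y
    simp only [AddMonoidHom.sub_apply, AddMonoidHom.comp_apply, AddMonoidHom.id_apply,
      AddMonoidHom.zero_apply] at this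
    linarith
  let G : ℤ × ℝ × ℝ →+ DissectionGroup V :=
    (zmultiplesHom _ (pointClass V)).coprod (σ.coprod q)
  have hGF : ∀ ρ, 0 ≤ ρ → ∀ z, dissectionParallelVolume hV ρ (G z)
      = z.2.2 + 2 * z.2.1 * ρ + Real.pi * z.1 * ρ ^ 2 := by
    rintro ρ hρ ⟨n, x, y⟩
    simp only [G, AddMonoidHom.coprod_apply, zmultiplesHom_apply, map_add, map_zsmul, hσF ρ hρ,
      hqF ρ hρ, dissectionParallelVolume_pointClass hV hρ, zsmul_eq_mul]
    ring
  have hinj : Function.Injective G := by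
    rw [injective_iff_map_eq_zero]
    rintro ⟨n, x, y⟩ h
    -- A polynomial of degree at most two in `ρ` that vanishes at `0`, `1` and `2` is zero.
    have h0 := hGF 0 le_rfl (n, x, y)
    have h1 := hGF 1 zero_le_one (n, x, y)
    have h2 := hGF 2 zero_le_two (n, x, y)
    rw [h, map_zero] at h0 h1 h2
    simp only at h0 h1 h2
    have hy : y = 0 := by linarith
    have hn : Real.pi * n = 0 := by linarith
    have hx : x = 0 := by linarith
    have hn' : n = 0 := by simpa [Real.pi_ne_zero] using hn
    simp [hx, hy, hn']
  have hsurj' : Function.Surjective G := fun k => by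
    obtain ⟨n, x, y, rfl⟩ := hsurj k
    exact ⟨(n, x, y), by simp [G, add_assoc]⟩
  refine ⟨(AddEquiv.ofBijective G ⟨hinj, hsurj'⟩).symm, fun ρ hρ k => ?_⟩
  have := hGF ρ hρ ((AddEquiv.ofBijective G ⟨hinj, hsurj'⟩).symm k)
  rw [← this]
  congr 1
  exact ((AddEquiv.ofBijective G ⟨hinj, hsurj'⟩).apply_symm_apply k).symm

theorem steinerPolynomial_eq {K : Set V} {p : Polynomial ℝ} (hp : IsSteinerPolynomial K p) :
    steinerPolynomial K = p := by
  have h : ∃ p, IsSteinerPolynomial K p := ⟨p, hp⟩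
  rw [steinerPolynomial, dif_pos h]
  refine Polynomial.eq_of_infinite_eval_eq _ _ ((Ici_infinite (0 : ℝ)).mono fun ρ hρ => ?_)
  exact (h.choose_spec ρ hρ).symm.trans (hp ρ hρ)

theorem unitBallVolume_zero : unitBallVolume 0 = 1 := by
  have h : Metric.closedBall (0 : EuclideanSpace ℝ (Fin 0)) 1 = {0} := by
    ext x
    simp [Subsingleton.elim x 0]
  rw [unitBallVolume, h, measureReal_def, volume_euclideanSpace_eq_dirac]
  simp

theorem unitBallVolume_one : unitBallVolume 1 = 2 := by
  rw [unitBallVolume, measureReal_def,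
    InnerProductSpace.volume_closedBall_of_dim_odd (k := 0) (by simp)]
  simp

theorem unitBallVolume_two : unitBallVolume 2 = Real.pi := by
  rw [unitBallVolume, volume_real_closedBall_of_finrank_eq_two (by simp) zero_le_one]
  simp

/-- The coordinates exhibit a Steiner polynomial for each polytope; dividing its coefficients by the
ball volumes `π`, `2` and `1` gives back the coordinates. -/
theorem exists_dissectionGroup_equiv_polytopeVolume (hV : Module.finrank ℝ V = 2) :
    ∃ Φ : DissectionGroup V ≃+ ℤ × ℝ × ℝ,
      (∀ C : Polytope V, ((Φ (polytopeClass C)).1 : ℝ) = polytopeVolume 0 C ∧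
        (Φ (polytopeClass C)).2.1 = polytopeVolume 1 C ∧
        (Φ (polytopeClass C)).2.2 = polytopeVolume 2 C) ∧
      ∀ ρ, 0 ≤ ρ → ∀ k, dissectionParallelVolume hV ρ k
        = (Φ k).2.2 + 2 * (Φ k).2.1 * ρ + Real.pi * (Φ k).1 * ρ ^ 2 := by
  obtain ⟨Φ, hΦ⟩ := exists_dissectionGroup_equiv hV
  refine ⟨Φ, fun C => ?_, hΦ⟩
  have hst : IsSteinerPolynomial C.1 (Polynomial.C (Φ (polytopeClass C)).2.2
      + Polynomial.C (2 * (Φ (polytopeClass C)).2.1) * Polynomial.X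
      + Polynomial.C (Real.pi * (Φ (polytopeClass C)).1) * Polynomial.X ^ 2) := by
    intro ρ hρ
    have := hΦ ρ hρ (polytopeClass C)
    rw [dissectionParallelVolume_polytopeClass] at this
    rw [← parallelVolume, this]
    simp
  have hcoeff : ∀ x y z : ℝ, (Polynomial.C x + Polynomial.C y * Polynomial.X
      + Polynomial.C z * Polynomial.X ^ 2).coeff 2 = z ∧ (Polynomial.C x
      + Polynomial.C y * Polynomial.X + Polynomial.C z * Polynomial.X ^ 2).coeff 1 = y ∧
      (Polynomial.C x + Polynomial.C y * Polynomial.X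
      + Polynomial.C z * Polynomial.X ^ 2).coeff 0 = x := fun x y z => by
    refine ⟨?_, ?_, ?_⟩ <;> simp [Polynomial.coeff_X, Polynomial.coeff_C, Polynomial.coeff_X_pow]
  obtain ⟨c2, c1, c0⟩ := hcoeff (Φ (polytopeClass C)).2.2 (2 * (Φ (polytopeClass C)).2.1)
    (Real.pi * (Φ (polytopeClass C)).1)
  have hπ := Real.pi_ne_zero
  refine ⟨?_, ?_, ?_⟩ <;> rw [polytopeVolume, intrinsicVolume, steinerPolynomial_eq hst, hV]
  · simp [unitBallVolume_two, -map_mul, c2, hπ]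
  · simp [unitBallVolume_one, -map_mul, c1]
  · simp [unitBallVolume_zero]

end SteinerFormula

/-! ### Extension of valuations to the relative Boolean algebra. -/

section ValuationExtension

variable {V : Type*} [NormedAddCommGroup V] [InnerProductSpace ℝ V]
  {A B : Type*} [AddCommGroup A] [AddCommGroup B]

theorem IsExtPolytope.exists_subset_polytope {P : Set V} (hP : IsExtPolytope P) :
    ∃ C : Set V, IsPolytope C ∧ P ⊆ C := by
  induction hP with
  | polytope C hC => exact ⟨C, hC, subset_rfl⟩
  | union P Q _ _ hP hQ =>
    obtain ⟨_, ⟨s, hs, rfl⟩, hPs⟩ := hP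
    obtain ⟨_, ⟨t, ht, rfl⟩, hQt⟩ := hQ
    exact ⟨convexHull ℝ (s ∪ t), ⟨s ∪ t, hs.union ht, rfl⟩, Set.union_subset
      (hPs.trans (convexHull_mono Set.subset_union_left))
      (hQt.trans (convexHull_mono Set.subset_union_right))⟩
  | inter P Q _ _ hP _ =>
    obtain ⟨C, hC, hPC⟩ := hP
    exact ⟨C, hC, Set.inter_subset_left.trans hPC⟩
  | diff P Q _ _ hP _ =>
    obtain ⟨C, hC, hPC⟩ := hP
    exact ⟨C, hC, Set.sdiff_subset.trans hPC⟩

namespace IsValuationExtension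

variable {φ : Polytope V → A} {ψ ψ₁ ψ₂ : ExtPolytope V → A}

theorem comp (h : IsValuationExtension φ ψ) (L : A →+ B) :
    IsValuationExtension (fun C => L (φ C)) (fun P => L (ψ P)) where
  extends_polytope C := congrArg L (h.extends_polytope C)
  empty E hE := by rw [h.empty E hE, map_zero]
  union_add_inter P Q := by rw [← map_add, h.union_add_inter, map_add]

theorem apply_diff (h : IsValuationExtension φ ψ) (P Q : ExtPolytope V) :
    ψ ⟨P.1 \ Q.1, .diff _ _ P.2 Q.2⟩ = ψ P - ψ ⟨P.1 ∩ Q.1, .inter _ _ P.2 Q.2⟩ := by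
  have key := h.union_add_inter ⟨P.1 \ Q.1, .diff _ _ P.2 Q.2⟩ ⟨P.1 ∩ Q.1, .inter _ _ P.2 Q.2⟩
  have e1 : (⟨P.1 \ Q.1 ∪ P.1 ∩ Q.1,
      .union _ _ (.diff _ _ P.2 Q.2) (.inter _ _ P.2 Q.2)⟩ : ExtPolytope V) = P :=
    Subtype.ext (Set.sdiff_union_inter P.1 Q.1)
  have e2 := h.empty ⟨P.1 \ Q.1 ∩ (P.1 ∩ Q.1),
    .inter _ _ (.diff _ _ P.2 Q.2) (.inter _ _ P.2 Q.2)⟩ (by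
      ext x
      simp
      tauto)
  simp only at key
  rw [e1, e2, add_zero] at key
  rw [key, add_sub_cancel_right]

/-- Agreement on `P` and `Q` alone says nothing about `P ∩ Q`. The induction therefore shows that
intersecting with `P` preserves the property of agreeing on the intersections with all polytopes.
Quantifying over `T` lets this be applied twice, to `P` and then to `Q`. -/
theorem unique [FiniteDimensional ℝ V] (h₁ : IsValuationExtension φ ψ₁)
    (h₂ : IsValuationExtension φ ψ₂) : ψ₁ = ψ₂ := by
  let agree : Set V → Prop := fun T => ∃ h : IsExtPolytope T, ψ₁ ⟨T, h⟩ = ψ₂ ⟨T, h⟩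
  have agree_polytope : ∀ C : Set V, IsPolytope C → agree C := fun C hC =>
    ⟨.polytope C hC, (h₁.extends_polytope ⟨C, hC⟩).trans (h₂.extends_polytope ⟨C, hC⟩).symm⟩
  have agree_union : ∀ P Q, agree P → agree Q → agree (P ∩ Q) → agree (P ∪ Q) := by
    rintro P Q ⟨hP, eP⟩ ⟨hQ, eQ⟩ ⟨hI, eI⟩
    refine ⟨.union P Q hP hQ, ?_⟩
    rw [eq_sub_of_add_eq (h₁.union_add_inter ⟨P, hP⟩ ⟨Q, hQ⟩),
      eq_sub_of_add_eq (h₂.union_add_inter ⟨P, hP⟩ ⟨Q, hQ⟩), eP, eQ, eI]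
  have agree_diff : ∀ P Q, IsExtPolytope Q → agree P → agree (P ∩ Q) → agree (P \ Q) := by
    rintro P Q hQ ⟨hP, eP⟩ ⟨hI, eI⟩
    refine ⟨.diff P Q hP hQ, ?_⟩
    rw [h₁.apply_diff ⟨P, hP⟩ ⟨Q, hQ⟩, h₂.apply_diff ⟨P, hP⟩ ⟨Q, hQ⟩, eP, eI]
  have key : ∀ P, IsExtPolytope P → ∀ T : Set V,
      (∀ C, IsPolytope C → agree (T ∩ C)) → ∀ C, IsPolytope C → agree (T ∩ P ∩ C) := by
    intro P hP
    induction hP with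
    | polytope D hD =>
      intro T hT C hC
      rw [Set.inter_assoc]
      exact hT _ (IsFiniteHull.inter hD hC)
    | inter P Q _ _ ihP ihQ =>
      intro T hT C hC
      rw [← Set.inter_assoc]
      exact ihQ _ (ihP T hT) C hC
    | union P Q _ _ ihP ihQ =>
      intro T hT C hC
      rw [Set.inter_union_distrib_left, Set.union_inter_distrib_right]
      refine agree_union _ _ (ihP T hT C hC) (ihQ T hT C hC) ?_
      convert ihQ _ (ihP T hT) C hC using 1
      ext x
      simp
      tauto
    | diff P Q _ hQ ihP ihQ =>
      intro T hT C hC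
      have e : T ∩ (P \ Q) ∩ C = (T ∩ P ∩ C) \ Q := by
        ext x
        simp
        tauto
      rw [e]
      refine agree_diff _ _ hQ (ihP T hT C hC) ?_
      rw [Set.inter_right_comm]
      exact ihQ _ (ihP T hT) C hC
  funext P
  obtain ⟨C, hC, hPC⟩ := P.2.exists_subset_polytope
  obtain ⟨h, e⟩ := key P.1 P.2 C (fun D hD => agree_polytope _ (IsFiniteHull.inter hC hD)) C hC
  have hset : (⟨C ∩ P.1 ∩ C, h⟩ : ExtPolytope V) = P := Subtype.ext (show C ∩ P.1 ∩ C = P.1 by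
    rw [Set.inter_eq_right.2 hPC, Set.inter_eq_left.2 hPC])
  rwa [hset] at e

end IsValuationExtension

/-- Since polytopes are closed under intersection, the span of their indicators is closed under
products. Hence it contains the indicators of all sets in the relative Boolean algebra. -/
theorem exists_polytopeIndicator_mul [FiniteDimensional ℝ V]
    (a b : FreeAbelianGroup (Polytope V)) :
    ∃ c, polytopeIndicator c = polytopeIndicator a * polytopeIndicator b := by
  induction a using FreeAbelianGroup.induction_on with
  | zero => exact ⟨0, by simp⟩
  | neg C ih =>
    obtain ⟨c, hc⟩ := ih
    exact ⟨-c, by rw [map_neg, hc, map_neg, neg_mul]⟩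
  | add x y ihx ihy =>
    obtain ⟨c, hc⟩ := ihx
    obtain ⟨d, hd⟩ := ihy
    exact ⟨c + d, by rw [map_add, hc, hd, map_add, add_mul]⟩
  | of C =>
    induction b using FreeAbelianGroup.induction_on with
    | zero => exact ⟨0, by simp⟩
    | neg D ih =>
      obtain ⟨c, hc⟩ := ih
      exact ⟨-c, by rw [map_neg, hc, map_neg, mul_neg]⟩
    | add x y ihx ihy =>
      obtain ⟨c, hc⟩ := ihx
      obtain ⟨d, hd⟩ := ihy
      exact ⟨c + d, by rw [map_add, hc, hd, map_add, mul_add]⟩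
    | of D =>
      refine ⟨FreeAbelianGroup.of ⟨C.1 ∩ D.1, IsFiniteHull.inter C.2 D.2⟩, ?_⟩
      refine (FreeAbelianGroup.lift_apply_of _ _).trans ?_
      simp only [polytopeIndicator, FreeAbelianGroup.lift_apply_of]
      ext x
      by_cases h1 : x ∈ C.1 <;> by_cases h2 : x ∈ D.1 <;> simp [h1, h2]

theorem IsExtPolytope.exists_polytopeIndicator [FiniteDimensional ℝ V] {P : Set V}
    (hP : IsExtPolytope P) : ∃ a, polytopeIndicator a = P.indicator fun _ => (1 : ℤ) := by
  classical
  induction hP with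
  | polytope C hC => exact ⟨FreeAbelianGroup.of ⟨C, hC⟩, FreeAbelianGroup.lift_apply_of _ _⟩
  | union P Q _ _ hP hQ =>
    obtain ⟨a, ha⟩ := hP
    obtain ⟨b, hb⟩ := hQ
    obtain ⟨c, hc⟩ := exists_polytopeIndicator_mul a b
    refine ⟨a + b - c, ?_⟩
    rw [map_sub, map_add, hc, ha, hb]
    ext x
    by_cases h1 : x ∈ P <;> by_cases h2 : x ∈ Q <;> simp [h1, h2]
  | inter P Q _ _ hP hQ =>
    obtain ⟨a, ha⟩ := hP
    obtain ⟨b, hb⟩ := hQ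
    obtain ⟨c, hc⟩ := exists_polytopeIndicator_mul a b
    refine ⟨c, ?_⟩
    rw [hc, ha, hb]
    ext x
    by_cases h1 : x ∈ P <;> by_cases h2 : x ∈ Q <;> simp [h1, h2]
  | diff P Q _ _ hP hQ =>
    obtain ⟨a, ha⟩ := hP
    obtain ⟨b, hb⟩ := hQ
    obtain ⟨c, hc⟩ := exists_polytopeIndicator_mul a b
    refine ⟨a - c, ?_⟩
    rw [map_sub, hc, ha, hb]
    ext x
    by_cases h1 : x ∈ P <;> by_cases h2 : x ∈ Q <;> simp [h1, h2]

theorem indicator_union_add_inter {α : Type*} (P Q : Set α) :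
    ((P ∪ Q).indicator fun _ => (1 : ℤ)) + ((P ∩ Q).indicator fun _ => (1 : ℤ))
      = (P.indicator fun _ => (1 : ℤ)) + Q.indicator fun _ => (1 : ℤ) := by
  ext x
  by_cases h1 : x ∈ P <;> by_cases h2 : x ∈ Q <;> simp [h1, h2]

/-- A function on polytopes that respects the linear relations between indicator functions
extends to a valuation. -/
theorem exists_isValuationExtension [FiniteDimensional ℝ V] (φ : Polytope V → A)
    (hφ : ∀ a, polytopeIndicator a = 0 → FreeAbelianGroup.lift φ a = 0) :
    ∃ ψ : ExtPolytope V → A, IsValuationExtension φ ψ := by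
  classical
  choose rep hrep using fun P : ExtPolytope V => P.2.exists_polytopeIndicator
  refine ⟨fun P => FreeAbelianGroup.lift φ (rep P), fun C => ?_, fun E hE => ?_, fun P Q => ?_⟩
  · have := hφ (rep ⟨C.1, .polytope C.1 C.2⟩ - FreeAbelianGroup.of C) (by
      rw [map_sub, hrep ⟨C.1, .polytope C.1 C.2⟩, sub_eq_zero]
      exact (FreeAbelianGroup.lift_apply_of (fun C : Polytope V => C.1.indicator fun _ => (1 : ℤ))
        C).symm)
    rw [map_sub, sub_eq_zero] at this
    rw [this, FreeAbelianGroup.lift_apply_of]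
  · refine hφ _ ?_
    rw [hrep, hE, Set.indicator_empty]
    rfl
  · rw [← sub_eq_zero, ← map_add, ← map_add, ← map_sub]
    refine hφ _ ?_
    rw [map_sub, map_add, map_add, hrep P, hrep Q, hrep ⟨P.1 ∪ Q.1, .union _ _ P.2 Q.2⟩,
      hrep ⟨P.1 ∩ Q.1, .inter _ _ P.2 Q.2⟩]
    exact sub_eq_zero.2 (indicator_union_add_inter P.1 Q.1)

theorem isValuationExtension_valuationExtension {φ : Polytope V → A}
    (h : ∃ ψ : ExtPolytope V → A, IsValuationExtension φ ψ) :
    IsValuationExtension φ (valuationExtension φ) := by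
  rw [valuationExtension, dif_pos h]
  exact h.choose_spec

end ValuationExtension

/-! ### The main theorem. -/

theorem corollary4p2 {V : Type*} [NormedAddCommGroup V] [InnerProductSpace ℝ V]
    [FiniteDimensional ℝ V] [MeasurableSpace V] [BorelSpace V]
    (hV : Module.finrank ℝ V = 2) :
    (∃ Φ : DissectionGroup V ≃+ ℤ × ℝ × ℝ, ∀ C : Polytope V,
      ((Φ (polytopeClass C)).1 : ℝ) = polytopeVolume 0 C ∧
      (Φ (polytopeClass C)).2.1 = polytopeVolume 1 C ∧
      (Φ (polytopeClass C)).2.2 = polytopeVolume 2 C) ∧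
    (∃! ψ : ExtPolytope V → DissectionGroup V, IsValuationExtension polytopeClass ψ) ∧
    (∀ i ≤ 2, ∃! ψ : ExtPolytope V → ℝ, IsValuationExtension (polytopeVolume i) ψ) ∧
    (∀ P P' : ExtPolytope V,
      extClass P = extClass P' ↔ ∀ i ≤ 2, extVolume i P = extVolume i P') := by
  obtain ⟨Φ, hΦ, hF⟩ := exists_dissectionGroup_equiv_polytopeVolume hV
  have hlift : ∀ a : FreeAbelianGroup (Polytope V),
      FreeAbelianGroup.lift polytopeClass a = (QuotientAddGroup.mk a : DissectionGroup V) :=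
    fun a => DFunLike.congr_fun (FreeAbelianGroup.lift_ext
      (FreeAbelianGroup.lift polytopeClass) (QuotientAddGroup.mk'
        (AddSubgroup.closure {x | DissectionRel (V := V) x})) fun C => by
        rw [FreeAbelianGroup.lift_apply_of]
        rfl) a
  -- An indicator relation has zero parallel volume for every `ρ`, so all coordinates of its class
  -- under `Φ` vanish.
  have hclass : ∃ ψ : ExtPolytope V → DissectionGroup V, IsValuationExtension polytopeClass ψ := by
    refine exists_isValuationExtension _ fun a ha => ?_
    rw [hlift, ← Φ.map_eq_zero_iff]
    have hρ : ∀ ρ : ℝ, dissectionParallelVolume hV ρ (QuotientAddGroup.mk a) = 0 := fun ρ =>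
      freeParallelVolume_eq_zero hV ρ ha
    have h0 := hF 0 le_rfl (QuotientAddGroup.mk a)
    have h1 := hF 1 zero_le_one (QuotientAddGroup.mk a)
    have h2 := hF 2 zero_le_two (QuotientAddGroup.mk a)
    rw [hρ] at h0 h1 h2
    generalize Φ (QuotientAddGroup.mk a) = z at h0 h1 h2
    obtain ⟨n, x, y⟩ := z
    simp only at h0 h1 h2
    have hy : y = 0 := by linarith
    have hn : Real.pi * n = 0 := by linarith
    have hx : x = 0 := by linarith
    have hn' : n = 0 := by simpa [Real.pi_ne_zero] using hn
    rw [hx, hy, hn']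
    rfl
  have hext : IsValuationExtension polytopeClass (extClass (V := V)) :=
    isValuationExtension_valuationExtension hclass
  let L₀ : ℤ × ℝ × ℝ →+ ℝ := (Int.castAddHom ℝ).comp (AddMonoidHom.fst ℤ (ℝ × ℝ))
  let L₁ : ℤ × ℝ × ℝ →+ ℝ := (AddMonoidHom.fst ℝ ℝ).comp (AddMonoidHom.snd ℤ (ℝ × ℝ))
  let L₂ : ℤ × ℝ × ℝ →+ ℝ := (AddMonoidHom.snd ℝ ℝ).comp (AddMonoidHom.snd ℤ (ℝ × ℝ))
  -- The coordinates of `Φ (extClass P)` are valuations extending the intrinsic volumes, and by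
  -- uniqueness they are the functions `extVolume i`.
  have hvol : ∀ (i : ℕ) (L : ℤ × ℝ × ℝ →+ ℝ),
      (∀ C : Polytope V, L (Φ (polytopeClass C)) = polytopeVolume i C) →
      IsValuationExtension (polytopeVolume i) (fun P : ExtPolytope V => L (Φ (extClass P))) := by
    intro i L hL
    have := hext.comp (L.comp Φ.toAddMonoidHom)
    rwa [show (fun C : Polytope V => (L.comp Φ.toAddMonoidHom) (polytopeClass C))
      = polytopeVolume i from funext hL] at this
  have hvol₀ := hvol 0 L₀ fun C => (hΦ C).1
  have hvol₁ := hvol 1 L₁ fun C => (hΦ C).2.1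
  have hvol₂ := hvol 2 L₂ fun C => (hΦ C).2.2
  have hvolExt : ∀ i (ψ : ExtPolytope V → ℝ), IsValuationExtension (polytopeVolume i) ψ →
      ∀ P, extVolume i P = ψ P := fun i ψ hψ P =>
    congr_fun ((isValuationExtension_valuationExtension ⟨ψ, hψ⟩).unique hψ) P
  refine ⟨⟨Φ, hΦ⟩, ⟨_, hext, fun ψ hψ => hψ.unique hext⟩, fun i hi => ?_, fun P P' => ?_⟩
  · interval_cases i
    · exact ⟨_, hvol₀, fun ψ hψ => hψ.unique hvol₀⟩
    · exact ⟨_, hvol₁, fun ψ hψ => hψ.unique hvol₁⟩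
    · exact ⟨_, hvol₂, fun ψ hψ => hψ.unique hvol₂⟩
  · constructor
    · intro h i hi
      interval_cases i
      · rw [hvolExt 0 _ hvol₀, hvolExt 0 _ hvol₀, h]
      · rw [hvolExt 1 _ hvol₁, hvolExt 1 _ hvol₁, h]
      · rw [hvolExt 2 _ hvol₂, hvolExt 2 _ hvol₂, h]
    · intro h
      have e0 := h 0 (by norm_num)
      have e1 := h 1 (by norm_num)
      have e2 := h 2 (by norm_num)
      rw [hvolExt 0 _ hvol₀, hvolExt 0 _ hvol₀] at e0
      rw [hvolExt 1 _ hvol₁, hvolExt 1 _ hvol₁] at e1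
      rw [hvolExt 2 _ hvol₂, hvolExt 2 _ hvol₂] at e2
      refine Φ.injective (Prod.ext ?_ (Prod.ext e1 e2))
      exact Int.cast_injective (α := ℝ) e0
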